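/- Let $n\ge 0$ be an integer, $r\ge 0$, and let $\mathcal C=\mathcal C([-r,0],\mathbb R^n)$ carry the supremum norm; inequalities in $\mathbb R^n$ are componentwise and inequalities in $\mathcal C$ are pointwise. For $v\in\mathbb R^n$ let $v\mathbb 1\in\mathcal C$ be the constant function with value $v$, and for a function $x$ continuous on $[t-r,t]$ let $x_t\in\mathcal C$, $x_t(\theta)=x(t+\theta)$. Let $f:\mathbb R^n\to\mathbb R^n$ and $g^t:\mathcal C\to\mathbb R^n$ ($t\ge 0$) satisfy: (i) if $x\le y$ and $x_i=y_i$, then $f_i(x)\le f_i(y)$, for all $x,y\in\mathbb R^n$ and every index $i$; (ii) if $\phi\le\psi$, then $g^t(\phi)\le g^t(\psi)$, for all $\phi,\psi\in\mathcal C$ and $t\ge0$; (iii) $f$ is locally Lipschitz, $g^t$ is locally Lipschitz for each fixed $t\ge 0$, and $t\mapsto g^t(\phi)$ is continuous on $[0,\infty)$ for each fixed $\phi\in\mathcal C$; (iv) for each $v\in\mathbb R^n$, $g^t(v\mathbb 1)$ does not depend on $t\ge 0$; (v) $f(0)+g^t(0\cdot\mathbb 1)=0$ for all $t\ge0$, i.e.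 the origin is an equilibrium. For $t_0\ge 0$ and $t_0<T\le\infty$, a solution on $[t_0,T)$ of the delayed system $$\frac{dx}{dt}(t)=f(x(t))+g^t(x_t)\qquad(\ast)$$ is a continuous function $x:[t_0-r,T)\to\mathbb R^n$ satisfying $(\ast)$ for all $t\in[t_0,T)$ (with the right-hand derivative at $t_0$). Suppose that the undelayed system $\frac{dy}{dt}(t)=f(y(t))+g^t(y(t)\mathbb 1)$, which is autonomous by (iv) and is therefore meaningful for all $t\in\mathbb R$, admits a solution $y:\mathbb R\to\mathbb R^n$ with $\lim_{t\to-\infty}y_i(t)=\infty$ and $\lim_{t\to\infty}y_i(t)=0$ for every component $i$. Then the origin is globally asymptotically stable for $(\ast)$ on the nonnegative orthant. That is, for every $t_0\ge 0$: (a) for every $\phi\in\mathcal C$ with $\phi\ge 0$ there is a solution $x$ of $(\ast)$ on $[t_0,\infty)$ with $x_{t_0}=\phi$, and every solution of $(\ast)$ on some $[t_0,T)$ with $x_{t_0}\ge0$ extends to a solution on $[t_0,\infty)$; (b) (stability) for every $\varepsilon>0$ there is $\delta>0$ such that every solution $x$ of $(\ast)$ on an interval $[t_0,T)$ with $x_{t_0}\ge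 0$ and $\|x_{t_0}\|<\delta$ satisfies $x_t\ge 0$ and $\|x_t\|<\varepsilon$ for all $t\in[t_0,T)$; (c) (global attractivity) every solution $x$ of $(\ast)$ on $[t_0,\infty)$ with $x_{t_0}\ge0$ satisfies $\lim_{t\to\infty}x(t)=0$. -/

import Mathlib

open Filter Topology Set

noncomputable section

/-- The Banach lattice `C([-r,0], ℝⁿ)`: sup norm, pointwise order. (The order, the topology and the
notion of local Lipschitz continuity on `ℝⁿ = Fin n → ℝ` do not depend on the choice of norm.) -/
abbrev History (n : ℕ) (r : ℝ) : Type := C(Icc (-r) (0 : ℝ), Fin n → ℝ)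

/-- The constant history `v 𝟙`. -/
def constHistory {n : ℕ} (r : ℝ) (v : Fin n → ℝ) : History n r :=
  ContinuousMap.const _ v

/-- The segment `x_t ∈ C([-r,0], ℝⁿ)`, `x_t(θ) = x(t + θ)`. (The default value `0` is used only when
`x` is not continuous on `[t - r, t]`, which never happens for solutions.) -/
def segment_at {n : ℕ} (r : ℝ) (x : ℝ → Fin n → ℝ) (t : ℝ) : History n r :=
  ContinuousMap.mkD (fun θ : Icc (-r) (0 : ℝ) => x (t + θ)) 0

/-- `x` is a solution on `[t₀, T)`, `t₀ < T ≤ ∞`, of the delayed system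
`dx/dt (t) = f (x t) + gᵗ(x_t)`: it is continuous on `[t₀ - r, T)` and satisfies the equation at every
`t ∈ [t₀, T)` (with the right-hand derivative at `t₀`). Values of `x` outside `[t₀ - r, T)` are
irrelevant. -/
structure IsDelayedSolution {n : ℕ} (r : ℝ) (f : (Fin n → ℝ) → (Fin n → ℝ))
    (g : ℝ → History n r → (Fin n → ℝ)) (t₀ : ℝ) (T : EReal) (x : ℝ → Fin n → ℝ) : Prop where
  lt : (t₀ : EReal) < T
  continuousOn : ContinuousOn x {t : ℝ | t₀ - r ≤ t ∧ (t : EReal) < T}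
  hasDeriv : ∀ t : ℝ, t₀ ≤ t → (t : EReal) < T →
    HasDerivWithinAt x (f (x t) + g t (segment_at r x t)) (Ici t₀) t

/-- `y : ℝ → ℝⁿ` is a solution, on the whole time axis, of the undelayed system
`dy/dt (t) = f (y t) + gᵗ(y(t) 𝟙)`. The functionals `gᵗ` are given for `t ≥ 0` only; the right-hand
side does not depend on `t ≥ 0` (standing assumption on `gᵗ`), and this autonomous equation is the one
meant at negative times, where `g⁰` is used. -/
def IsEntireUndelayedSolution {n : ℕ} (r : ℝ) (f : (Fin n → ℝ) → (Fin n → ℝ))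
    (g : ℝ → History n r → (Fin n → ℝ)) (y : ℝ → Fin n → ℝ) : Prop :=
  ∀ t : ℝ, HasDerivAt y (f (y t) + g (max t 0) (constHistory r (y t))) t

/-- Stability of the origin for the delayed system, all regions being restricted to the cone of
nonnegative histories. -/
def IsStableOnCone {n : ℕ} (r : ℝ) (f : (Fin n → ℝ) → (Fin n → ℝ))
    (g : ℝ → History n r → (Fin n → ℝ)) : Prop :=
  ∀ t₀ : ℝ, 0 ≤ t₀ → ∀ ε : ℝ, 0 < ε → ∃ δ : ℝ, 0 < δ ∧
    ∀ (T : EReal) (x : ℝ → Fin n → ℝ), IsDelayedSolution r f g t₀ T x →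
      0 ≤ segment_at r x t₀ → ‖segment_at r x t₀‖ < δ →
      ∀ t : ℝ, t₀ ≤ t → (t : EReal) < T → 0 ≤ segment_at r x t ∧ ‖segment_at r x t‖ < ε

/-- Every nonnegative history prescribed at a time `t₀ ≥ 0` is the initial datum of a solution on
`[t₀, ∞)`, and every solution on some `[t₀, T)` with nonnegative initial datum extends to a solution on
`[t₀, ∞)` (no solution starting in the cone ceases to exist in finite time). -/
def IsForwardCompleteOnCone {n : ℕ} (r : ℝ) (f : (Fin n → ℝ) → (Fin n → ℝ))
    (g : ℝ → History n r → (Fin n → ℝ)) : Prop :=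
  ∀ t₀ : ℝ, 0 ≤ t₀ →
    (∀ φ : History n r, 0 ≤ φ →
      ∃ x : ℝ → Fin n → ℝ, IsDelayedSolution r f g t₀ ⊤ x ∧ segment_at r x t₀ = φ) ∧
    (∀ (T : EReal) (x : ℝ → Fin n → ℝ), IsDelayedSolution r f g t₀ T x →
      0 ≤ segment_at r x t₀ →
      ∃ z : ℝ → Fin n → ℝ, IsDelayedSolution r f g t₀ ⊤ z ∧
        EqOn x z {t : ℝ | t₀ - r ≤ t ∧ (t : EReal) < T})

/-- The origin is globally asymptotically stable for the delayed system on the nonnegative orthant: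
it is stable, and every solution with a nonnegative initial history tends to `0`. -/
structure IsGloballyAsymptoticallyStable {n : ℕ} (r : ℝ) (f : (Fin n → ℝ) → (Fin n → ℝ))
    (g : ℝ → History n r → (Fin n → ℝ)) : Prop where
  stable : IsStableOnCone r f g
  attractive : ∀ t₀ : ℝ, 0 ≤ t₀ → ∀ x : ℝ → Fin n → ℝ, IsDelayedSolution r f g t₀ ⊤ x →
    0 ≤ segment_at r x t₀ → Tendsto x atTop (𝓝 0)

end

open scoped NNReal

/-! Write F(v) = f(v) + g⁰(v𝟙) (`undelayedField`). The signs of F at constant vectors control the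
delayed system whatever the delay. When a solution first touches a wall of a constant box,
quasimonotonicity of f, monotonicity of gᵗ and time-independence of gᵗ(v𝟙) compare its velocity
there with F. Hence F(v) ≤ 0 makes v an upper barrier and F(v) ≥ 0 a lower one
(`le_of_field_nonpos`, `ge_of_field_nonneg`). Since F(0) = 0, the cone is invariant.

Upper barriers come from y: put v_i = min of y_i over (-∞, s]. If the minimum is attained at σ, then
v ≤ y(σ) with equality in coordinate i, so F_i(v) ≤ y_i'(σ) ≤ 0 (`exists_running_min`). Very
negative s gives arbitrarily large boxes, hence boundedness; large s gives arbitrarily small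
positive ones, hence stability.

For attractivity, the vector M of upper limits of a solution satisfies F(M) ≥ 0
(`field_limsup_nonneg`). Some y(s) lies above M, the undelayed flow then keeps y above M, and y → 0
forces M ≤ 0.

Existence also rests on order: the Lipschitz constants of gᵗ are not controlled in t, so a solution
in [0, v] is obtained as a fixed point of a monotone integral operator (`exists_solution`).
Solutions on bounded intervals are continued by gluing, and uniqueness is never needed. -/

/-! ### First-contact comparison principles. -/

/-- A function lying above its value at `t` on the left of `t` has nonpositive derivative at `t`. -/
theorem HasDerivAt.nonpos_of_left_ge {u : ℝ → ℝ} {u' a t : ℝ} (hu : HasDerivAt u u' t) (hat : a < t)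
    (h : ∀ s ∈ Ico a t, u t ≤ u s) : u' ≤ 0 := by
  have h1 : Tendsto (slope u t) (𝓝[<] t) (𝓝 u') :=
    hu.tendsto_slope.mono_left (nhdsWithin_mono _ fun s hs => ne_of_lt hs)
  refine le_of_tendsto h1 ?_
  filter_upwards [Ico_mem_nhdsLT hat] with s hs
  rw [slope_def_field]
  exact div_nonpos_of_nonneg_of_nonpos (sub_nonneg.2 (h s hs)) (sub_nonpos.2 hs.2.le)

/-- Comparison with a moving barrier `v + B(t) 𝟙` for vector-valued functions: if `x` starts below the
barrier, and at a first contact in the `i`-th coordinate moves slower than the barrier, then `x` stays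
below it. -/
theorem lt_barrier_of_contact {ι : Type*} [Fintype ι] {x x' : ℝ → ι → ℝ} {v : ι → ℝ} {B B' : ℝ → ℝ}
    {a b : ℝ} (hx : ContinuousOn x (Icc a b)) (hB : ContinuousOn B (Icc a b))
    (hx' : ∀ t ∈ Ioc a b, HasDerivAt x (x' t) t) (hB' : ∀ t ∈ Ioc a b, HasDerivAt B (B' t) t)
    (ha : ∀ i, x a i < v i + B a)
    (hc : ∀ t ∈ Ioc a b, (∀ s ∈ Icc a t, ∀ j, x s j ≤ v j + B s) →
      ∀ i, x t i = v i + B t → x' t i < B' t) :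
    ∀ t ∈ Icc a b, ∀ i, x t i < v i + B t := by
  by_contra! hcon
  have hxi : ∀ i, ContinuousOn (fun t => x t i) (Icc a b) := fun i => continuousOn_pi.1 hx i
  -- The set of bad times is compact, so it has a least element: the first contact.
  set A : Set ℝ := ⋃ i, {t ∈ Icc a b | v i + B t ≤ x t i} with hA
  have hAc : IsCompact A := by
    refine isCompact_iUnion fun i => isCompact_Icc.of_isClosed_subset ?_ fun t ht => ht.1
    exact isClosed_Icc.isClosed_le (continuousOn_const.add hB) (hxi i)
  have hAn : A.Nonempty := by
    obtain ⟨t, ht, i, hi⟩ := hcon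
    exact ⟨t, mem_iUnion.2 ⟨i, ht, hi⟩⟩
  obtain ⟨τ, hτA, hτ⟩ := hAc.exists_isLeast hAn
  obtain ⟨i, hτI, hi⟩ := mem_iUnion.1 hτA
  have haτ : a < τ := by
    rcases hτI.1.eq_or_lt with h | h
    · exact absurd hi (not_le.2 (h ▸ ha i))
    · exact h
  have hlt : ∀ s ∈ Ico a τ, ∀ j, x s j < v j + B s := by
    intro s hs j
    by_contra! h
    exact absurd (hτ (mem_iUnion.2 ⟨j, ⟨hs.1, hs.2.le.trans hτI.2⟩, h⟩)) (not_le.2 hs.2)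
  have hle : ∀ s ∈ Icc a τ, ∀ j, x s j ≤ v j + B s := by
    intro s hs j
    rcases hs.2.eq_or_lt with rfl | h
    · have hI : Ico a s ⊆ Icc a b := fun u hu => ⟨hu.1, hu.2.le.trans hτI.2⟩
      have : (𝓝[Ico a s] s).NeBot := by
        rw [nhdsWithin_Ico_eq_nhdsLT haτ]
        infer_instance
      exact le_of_tendsto_of_tendsto ((hxi j s hτI).mono hI)
        ((continuousOn_const.add hB s hτI).mono hI)
        (by filter_upwards [self_mem_nhdsWithin] with u hu using (hlt u hu j).le)
    · exact (hlt s ⟨hs.1, h⟩ j).le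
  have heq : x τ i = v i + B τ := le_antisymm (hle τ ⟨hτI.1, le_rfl⟩ i) hi
  have h1 := hc τ ⟨haτ, hτI.2⟩ hle i heq
  have h2 : HasDerivAt (fun t => B t - x t i) (B' τ - x' τ i) τ :=
    (hB' τ ⟨haτ, hτI.2⟩).sub (hasDerivAt_pi.1 (hx' τ ⟨haτ, hτI.2⟩) i)
  have h3 := h2.nonpos_of_left_ge haτ fun s hs => by
    have := hlt s hs i
    linarith
  linarith

/-- Invariance of a lower orthant `{u ≤ v}`: it suffices that, on contact with the slightly larger
orthant `{u ≤ v + μ 𝟙}`, the velocity of the coordinate in contact is `O(μ)`. -/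
theorem le_of_contact {ι : Type*} [Fintype ι] {x x' : ℝ → ι → ℝ} {v : ι → ℝ} {a b ρ K η : ℝ}
    (hK : 0 ≤ K) (hη : 0 < η)
    (hx : ContinuousOn x (Icc a b)) (hx' : ∀ t ∈ Ioc a b, HasDerivAt x (x' t) t)
    (ha : ∀ s ∈ Icc (a - ρ) a, ∀ i, x s i ≤ v i) (hρ : 0 ≤ ρ)
    (hc : ∀ t ∈ Ioc a b, ∀ μ, 0 < μ → μ ≤ η → (∀ s ∈ Icc (a - ρ) t, ∀ j, x s j ≤ v j + μ) →
      ∀ i, x t i = v i + μ → x' t i ≤ K * μ) :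
    ∀ t ∈ Icc a b, ∀ i, x t i ≤ v i := by
  intro t ht i
  have hab : a ≤ b := ht.1.trans ht.2
  -- The barrier μ(t) = ε exp((K+1)(t-a)) grows at rate (K+1)μ, strictly faster than the allowed Kμ.
  -- The bound by η keeps it where the contact hypothesis applies; then ε → 0.
  have key : ∀ ε, 0 < ε → ε * Real.exp ((K + 1) * (b - a)) ≤ η →
      x t i < v i + ε * Real.exp ((K + 1) * (t - a)) := by
    intro ε hε hεη
    have hder : ∀ s, HasDerivAt (fun s => ε * Real.exp ((K + 1) * (s - a)))
        ((K + 1) * (ε * Real.exp ((K + 1) * (s - a)))) s := by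
      intro s
      have := ((((hasDerivAt_id s).sub_const a).const_mul (K + 1)).exp).const_mul ε
      exact this.congr_deriv (by simp only [id]; ring)
    have hmono : ∀ s s', s ≤ s' →
        ε * Real.exp ((K + 1) * (s - a)) ≤ ε * Real.exp ((K + 1) * (s' - a)) := by
      intro s s' h
      gcongr
    refine lt_barrier_of_contact (B' := fun s => (K + 1) * (ε * Real.exp ((K + 1) * (s - a))))
      hx (fun s _ => (hder s).continuousAt.continuousWithinAt) hx' (fun s _ => hder s)
      (fun j => ?_) (fun s hs hle j hj => ?_) t ht i
    · have := ha a ⟨by linarith, le_rfl⟩ j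
      simpa using by linarith
    · have hpos : 0 < ε * Real.exp ((K + 1) * (s - a)) := by positivity
      have := hc s hs _ hpos ((hmono s b hs.2).trans hεη) (fun u hu k => ?_) j hj
      · linarith
      · rcases le_total u a with h | h
        · have := ha u ⟨hu.1, h⟩ k
          linarith
        · exact (hle u ⟨h, hu.2⟩ k).trans (by linarith [hmono u s hu.2])
  have hlim : Tendsto (fun ε : ℝ => v i + ε * Real.exp ((K + 1) * (t - a))) (𝓝[>] 0) (𝓝 (v i)) := by
    have : Tendsto (fun ε : ℝ => v i + ε * Real.exp ((K + 1) * (t - a))) (𝓝 0)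
        (𝓝 (v i + 0 * Real.exp ((K + 1) * (t - a)))) := by
      apply Continuous.tendsto; fun_prop
    simpa using this.mono_left nhdsWithin_le_nhds
  refine ge_of_tendsto hlim ?_
  have hE : 0 < Real.exp ((K + 1) * (b - a)) := Real.exp_pos _
  filter_upwards [Ioc_mem_nhdsGT (div_pos hη hE)] with ε hε
  exact (key ε hε.1 ((le_div_iff₀ hE).1 hε.2)).le

/-! ### The undelayed field, constant histories and segments. -/

/-- The vector field of the undelayed system. -/
def undelayedField {n : ℕ} (r : ℝ) (f : (Fin n → ℝ) → (Fin n → ℝ))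
    (g : ℝ → History n r → (Fin n → ℝ)) (v : Fin n → ℝ) : Fin n → ℝ :=
  f v + g 0 (constHistory r v)

/-- The standing assumptions on the delayed system. -/
structure IsMonotoneDelaySystem {n : ℕ} (r : ℝ) (f : (Fin n → ℝ) → (Fin n → ℝ))
    (g : ℝ → History n r → (Fin n → ℝ)) : Prop where
  r_nonneg : 0 ≤ r
  f_mono : ∀ x y : Fin n → ℝ, x ≤ y → ∀ i, x i = y i → f x i ≤ f y i
  g_mono : ∀ t : ℝ, 0 ≤ t → ∀ φ ψ : History n r, φ ≤ ψ → g t φ ≤ g t ψ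
  f_lip : LocallyLipschitz f
  g_lip : ∀ t : ℝ, 0 ≤ t → LocallyLipschitz (g t)
  g_cont : ∀ φ : History n r, ContinuousOn (fun t => g t φ) (Ici 0)
  g_const : ∀ v : Fin n → ℝ, ∀ t : ℝ, 0 ≤ t → g t (constHistory r v) = g 0 (constHistory r v)

theorem constHistory_mono {n : ℕ} {r : ℝ} {u v : Fin n → ℝ} (h : u ≤ v) :
    constHistory r u ≤ constHistory r v := fun _ => h

theorem lipschitzWith_constHistory (n : ℕ) (r : ℝ) :
    LipschitzWith 1 (constHistory r : (Fin n → ℝ) → History n r) :=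
  LipschitzWith.of_dist_le_mul fun u v => by
    rw [NNReal.coe_one, one_mul]
    exact (ContinuousMap.dist_le dist_nonneg).2 fun _ => le_rfl

namespace IsMonotoneDelaySystem

variable {n : ℕ} {r : ℝ} {f : (Fin n → ℝ) → (Fin n → ℝ)} {g : ℝ → History n r → (Fin n → ℝ)}

theorem field_mono (S : IsMonotoneDelaySystem r f g) {u v : Fin n → ℝ} (h : u ≤ v) {i : Fin n}
    (hi : u i = v i) : undelayedField r f g u i ≤ undelayedField r f g v i :=
  add_le_add (S.f_mono u v h i hi) (S.g_mono 0 le_rfl _ _ (constHistory_mono h) i)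

theorem locallyLipschitz_field (S : IsMonotoneDelaySystem r f g) :
    LocallyLipschitz (undelayedField r f g) :=
  S.f_lip.add ((S.g_lip 0 le_rfl).comp (lipschitzWith_constHistory n r).locallyLipschitz)

/-- Linear bounds for the undelayed field along the diagonal direction. -/
theorem exists_field_bound (S : IsMonotoneDelaySystem r f g) (v : Fin n → ℝ) :
    ∃ K η : ℝ, 0 ≤ K ∧ 0 < η ∧ ∀ μ : ℝ, |μ| ≤ η → ∀ i,
      |undelayedField r f g (fun j => v j + μ) i - undelayedField r f g v i| ≤ K * |μ| := by
  obtain ⟨K, U, hU, hL⟩ := S.locallyLipschitz_field v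
  obtain ⟨η, hη, hball⟩ := Metric.nhds_basis_closedBall.mem_iff.1 hU
  have hd : ∀ μ : ℝ, dist (fun j => v j + μ) v ≤ |μ| := fun μ =>
    (dist_pi_le_iff (abs_nonneg _)).2 fun j => by simp
  refine ⟨K, η, K.2, hη, fun μ hμ i => ?_⟩
  rw [← Real.dist_eq]
  refine (dist_le_pi_dist _ _ i).trans ((hL.dist_le_mul _ (hball ((hd μ).trans hμ)) _
    (mem_of_mem_nhds hU)).trans ?_)
  exact mul_le_mul_of_nonneg_left (hd μ) K.2

end IsMonotoneDelaySystem

theorem segment_at_apply {n : ℕ} {r : ℝ} {x : ℝ → Fin n → ℝ} {t : ℝ}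
    (hx : ContinuousOn x (Icc (t - r) t)) (θ : Icc (-r) (0 : ℝ)) :
    segment_at r x t θ = x (t + θ) := by
  have : Continuous fun θ : Icc (-r) (0 : ℝ) => x (t + θ) :=
    hx.comp_continuous (by fun_prop) fun θ => ⟨by linarith [θ.2.1], by linarith [θ.2.2]⟩
  rw [segment_at, ContinuousMap.mkD_of_continuous this]
  rfl

theorem segment_at_congr {n : ℕ} {r : ℝ} {x z : ℝ → Fin n → ℝ} {t : ℝ}
    (h : EqOn x z (Icc (t - r) t)) : segment_at r x t = segment_at r z t := by
  have : (fun θ : Icc (-r) (0 : ℝ) => x (t + θ)) = fun θ : Icc (-r) (0 : ℝ) => z (t + θ) :=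
    funext fun θ => h ⟨by linarith [θ.2.1], by linarith [θ.2.2]⟩
  rw [segment_at, segment_at, this]

theorem segment_at_le_segment_at {n : ℕ} {r : ℝ} {x z : ℝ → Fin n → ℝ} {t : ℝ}
    (hx : ContinuousOn x (Icc (t - r) t)) (hz : ContinuousOn z (Icc (t - r) t))
    (h : ∀ s ∈ Icc (t - r) t, x s ≤ z s) : segment_at r x t ≤ segment_at r z t := fun θ => by
  have := h (t + θ) ⟨by linarith [θ.2.1], by linarith [θ.2.2]⟩
  rw [← segment_at_apply hx, ← segment_at_apply hz] at this
  exact this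

theorem segment_at_le_constHistory_iff {n : ℕ} {r : ℝ} {x : ℝ → Fin n → ℝ} {t : ℝ}
    (hx : ContinuousOn x (Icc (t - r) t)) (v : Fin n → ℝ) :
    segment_at r x t ≤ constHistory r v ↔ ∀ s ∈ Icc (t - r) t, x s ≤ v := by
  refine ⟨fun h s hs => ?_, fun h θ => ?_⟩
  · have := ContinuousMap.le_def.1 h ⟨s - t, by linarith [hs.1], by linarith [hs.2]⟩
    rw [segment_at_apply hx] at this
    simpa [constHistory] using this
  · have := h (t + θ) ⟨by linarith [θ.2.1], by linarith [θ.2.2]⟩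
    rw [← segment_at_apply hx] at this
    exact this

theorem constHistory_le_segment_at_iff {n : ℕ} {r : ℝ} {x : ℝ → Fin n → ℝ} {t : ℝ}
    (hx : ContinuousOn x (Icc (t - r) t)) (v : Fin n → ℝ) :
    constHistory r v ≤ segment_at r x t ↔ ∀ s ∈ Icc (t - r) t, v ≤ x s := by
  refine ⟨fun h s hs => ?_, fun h θ => ?_⟩
  · have := ContinuousMap.le_def.1 h ⟨s - t, by linarith [hs.1], by linarith [hs.2]⟩
    rw [segment_at_apply hx] at this
    simpa [constHistory] using this
  · have := h (t + θ) ⟨by linarith [θ.2.1], by linarith [θ.2.2]⟩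
    rw [← segment_at_apply hx] at this
    exact this

/-! ### Constant barriers for the delayed system. -/

namespace IsDelayedSolution

variable {n : ℕ} {r : ℝ} {f : (Fin n → ℝ) → (Fin n → ℝ)} {g : ℝ → History n r → (Fin n → ℝ)}
  {t₀ : ℝ} {T : EReal} {x : ℝ → Fin n → ℝ}

theorem continuousOn_Icc (hx : IsDelayedSolution r f g t₀ T x) {a b : ℝ} (ha : t₀ - r ≤ a)
    (hb : (b : EReal) < T) : ContinuousOn x (Icc a b) :=
  hx.continuousOn.mono fun _ hs =>
    ⟨ha.trans hs.1, (EReal.coe_le_coe_iff.2 hs.2).trans_lt hb⟩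

theorem hasDerivAt (hx : IsDelayedSolution r f g t₀ T x) {t : ℝ} (ht : t₀ < t)
    (htT : (t : EReal) < T) : HasDerivAt x (f (x t) + g t (segment_at r x t)) t :=
  (hx.hasDeriv t ht.le htT).hasDerivAt (Ici_mem_nhds ht)

/-- Constant vectors at which the undelayed field is nonpositive are upper bounds for the solutions
starting below them. -/
theorem le_of_field_nonpos (S : IsMonotoneDelaySystem r f g) (hx : IsDelayedSolution r f g t₀ T x)
    (ht₀ : 0 ≤ t₀) {v : Fin n → ℝ} (hv : ∀ i, undelayedField r f g v i ≤ 0)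
    (h0 : segment_at r x t₀ ≤ constHistory r v) {t : ℝ} (ht : t₀ ≤ t) (htT : (t : EReal) < T) :
    segment_at r x t ≤ constHistory r v := by
  have hr := S.r_nonneg
  have hc₀ := hx.continuousOn_Icc le_rfl hx.lt
  obtain ⟨K, η, hK, hη, hb⟩ := S.exists_field_bound v
  rw [segment_at_le_constHistory_iff hc₀] at h0
  rw [segment_at_le_constHistory_iff (hx.continuousOn_Icc (by linarith) htT)]
  have key : ∀ s ∈ Icc t₀ t, ∀ i, x s i ≤ v i := by
    refine le_of_contact (ρ := r) (x' := fun s => f (x s) + g s (segment_at r x s)) hK hη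
      (hx.continuousOn_Icc (by linarith) htT)
      (fun s hs => hx.hasDerivAt hs.1 ((EReal.coe_le_coe_iff.2 hs.2).trans_lt htT)) h0 hr
      fun s hs μ hμ hμη hle i hi => ?_
    -- On contact the velocity of coordinate i is at most F_i(v + μ𝟙) ≤ F_i(v) + Kμ ≤ Kμ, the
    -- delayed term being compared with a constant history.
    have hs0 : 0 ≤ s := ht₀.trans hs.1.le
    have h1 : f (x s) i ≤ f (fun j => v j + μ) i :=
      S.f_mono _ _ (fun j => hle s ⟨by linarith [hs.1], le_rfl⟩ j) i hi
    have h2 : g s (segment_at r x s) i ≤ g 0 (constHistory r fun j => v j + μ) i := by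
      rw [← S.g_const _ s hs0]
      refine S.g_mono s hs0 _ _ ((segment_at_le_constHistory_iff (hx.continuousOn_Icc
        (by linarith [hs.1]) ((EReal.coe_le_coe_iff.2 hs.2).trans_lt htT)) _).2 fun u hu j =>
          hle u ⟨by linarith [hs.1, hu.1], hu.2⟩ j) i
    have h3 := (abs_le.1 (hb μ (by rwa [abs_of_pos hμ]) i)).2
    rw [abs_of_pos hμ] at h3
    have h4 : undelayedField r f g (fun j => v j + μ) i
      = f (fun j => v j + μ) i + g 0 (constHistory r fun j => v j + μ) i := rfl
    simp only [Pi.add_apply]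
    linarith [hv i]
  intro s hs
  rcases le_total s t₀ with h | h
  · exact h0 s ⟨by linarith [hs.1], h⟩
  · exact key s ⟨h, hs.2⟩

/-- Constant vectors at which the undelayed field is nonnegative are lower bounds for the solutions
starting above them. -/
theorem ge_of_field_nonneg (S : IsMonotoneDelaySystem r f g) (hx : IsDelayedSolution r f g t₀ T x)
    (ht₀ : 0 ≤ t₀) {v : Fin n → ℝ} (hv : ∀ i, 0 ≤ undelayedField r f g v i)
    (h0 : constHistory r v ≤ segment_at r x t₀) {t : ℝ} (ht : t₀ ≤ t) (htT : (t : EReal) < T) :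
    constHistory r v ≤ segment_at r x t := by
  have hr := S.r_nonneg
  have hc₀ := hx.continuousOn_Icc le_rfl hx.lt
  obtain ⟨K, η, hK, hη, hb⟩ := S.exists_field_bound v
  rw [constHistory_le_segment_at_iff hc₀] at h0
  rw [constHistory_le_segment_at_iff (hx.continuousOn_Icc (by linarith) htT)]
  have key : ∀ s ∈ Icc t₀ t, ∀ i, (-x s) i ≤ (-v) i := by
    refine le_of_contact (ρ := r) (x' := fun s => -(f (x s) + g s (segment_at r x s))) hK hη
      (hx.continuousOn_Icc (by linarith) htT).neg
      (fun s hs => (hx.hasDerivAt hs.1 ((EReal.coe_le_coe_iff.2 hs.2).trans_lt htT)).neg)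
      (fun s hs i => neg_le_neg (h0 s hs i)) hr
      fun s hs μ hμ hμη hle i hi => ?_
    have hs0 : 0 ≤ s := ht₀.trans hs.1.le
    have hle' : ∀ u ∈ Icc (t₀ - r) s, ∀ j, v j + -μ ≤ x u j := fun u hu j => by
      have := hle u hu j
      simp only [Pi.neg_apply] at this
      linarith
    have h1 : f (fun j => v j + -μ) i ≤ f (x s) i :=
      S.f_mono _ _ (fun j => hle' s ⟨by linarith [hs.1], le_rfl⟩ j) i (by
        simp only [Pi.neg_apply] at hi
        linarith)
    have h2 : g 0 (constHistory r fun j => v j + -μ) i ≤ g s (segment_at r x s) i := by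
      rw [← S.g_const _ s hs0]
      refine S.g_mono s hs0 _ _ ((constHistory_le_segment_at_iff (hx.continuousOn_Icc
        (by linarith [hs.1]) ((EReal.coe_le_coe_iff.2 hs.2).trans_lt htT)) _).2 fun u hu j =>
          hle' u ⟨by linarith [hs.1, hu.1], hu.2⟩ j) i
    have h3 := (abs_le.1 (hb (-μ) (by rwa [abs_neg, abs_of_pos hμ]) i)).1
    rw [abs_neg, abs_of_pos hμ] at h3
    have h4 : undelayedField r f g (fun j => v j + -μ) i
      = f (fun j => v j + -μ) i + g 0 (constHistory r fun j => v j + -μ) i := rfl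
    simp only [Pi.add_apply, Pi.neg_apply]
    linarith [hv i]
  intro s hs
  rcases le_total s t₀ with h | h
  · exact h0 s ⟨by linarith [hs.1], h⟩
  · exact fun i => neg_le_neg_iff.1 (key s ⟨h, hs.2⟩ i)

end IsDelayedSolution

/-! ### Order properties of the undelayed flow. -/

section Undelayed

variable {n : ℕ} {r : ℝ} {f : (Fin n → ℝ) → (Fin n → ℝ)} {g : ℝ → History n r → (Fin n → ℝ)}
  {y : ℝ → Fin n → ℝ}

theorem IsMonotoneDelaySystem.hasDerivAt_undelayed (S : IsMonotoneDelaySystem r f g)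
    (hy : IsEntireUndelayedSolution r f g y) (t : ℝ) :
    HasDerivAt y (undelayedField r f g (y t)) t := by
  rw [undelayedField, ← S.g_const _ (max t 0) (le_max_right _ _)]
  exact hy t

/-- The contact argument applied to -y with no past. It will keep y above the upper limits of a
delayed solution. -/
theorem IsMonotoneDelaySystem.undelayed_ge (S : IsMonotoneDelaySystem r f g)
    (hy : IsEntireUndelayedSolution r f g y) {v : Fin n → ℝ}
    (hv : ∀ i, 0 ≤ undelayedField r f g v i) {a b : ℝ} (hab : a ≤ b) (ha : v ≤ y a) : v ≤ y b := by
  obtain ⟨K, η, hK, hη, hb⟩ := S.exists_field_bound v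
  have hd := S.hasDerivAt_undelayed hy
  have key : ∀ s ∈ Icc a b, ∀ i, (-y s) i ≤ (-v) i := by
    refine le_of_contact (ρ := 0) (x' := fun s => -undelayedField r f g (y s)) hK hη
      (fun s _ => (hd s).neg.continuousAt.continuousWithinAt) (fun s _ => (hd s).neg)
      (fun s hs i => ?_) le_rfl fun s hs μ hμ hμη hle i hi => ?_
    · rw [sub_zero, Icc_self] at hs
      rw [hs]
      exact neg_le_neg (ha i)
    · have h1 : undelayedField r f g (fun j => v j + -μ) i ≤ undelayedField r f g (y s) i := by
        refine S.field_mono (fun j => ?_) ?_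
        · have := hle s ⟨by linarith [hs.1], le_rfl⟩ j
          simp only [Pi.neg_apply] at this
          linarith
        · simp only [Pi.neg_apply] at hi
          linarith
      have h3 := (abs_le.1 (hb (-μ) (by rwa [abs_neg, abs_of_pos hμ]) i)).1
      rw [abs_neg, abs_of_pos hμ] at h3
      simp only [Pi.neg_apply]
      linarith [hv i]
  exact fun i => neg_le_neg_iff.1 (key b ⟨hab, le_rfl⟩ i)

/-- Since F(0) = 0 and F is Lipschitz near 0, a coordinate touching the level μ from above falls at
speed at most Kμ, so y stays above a barrier decaying at the faster rate K+1. Strict positivity is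
what later leaves room for δ in the stability estimate. -/
theorem IsMonotoneDelaySystem.undelayed_pos (S : IsMonotoneDelaySystem r f g)
    (h_eq : undelayedField r f g 0 = 0) (hy : IsEntireUndelayedSolution r f g y)
    {a b : ℝ} (hab : a ≤ b) (ha : ∀ i, 0 < y a i) (i : Fin n) : 0 < y b i := by
  obtain ⟨K, η, hK, hη, hb⟩ := S.exists_field_bound (0 : Fin n → ℝ)
  have hd := S.hasDerivAt_undelayed hy
  obtain ⟨c, hc, hcη, hca⟩ : ∃ c > 0, c ≤ η ∧ ∀ i, c < y a i := by
    have : ∀ᶠ c in 𝓝[>] (0 : ℝ), c ∈ Ioc 0 η ∧ ∀ i, c < y a i := by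
      refine Filter.Eventually.and (Ioc_mem_nhdsGT hη) (eventually_all.2 fun i => ?_)
      exact mem_of_superset (Ioo_mem_nhdsGT (ha i)) fun c hc => hc.2
    obtain ⟨c, h1, h2⟩ := this.exists
    exact ⟨c, h1.1, h1.2, h2⟩
  have hder : ∀ s, HasDerivAt (fun s => -(c * Real.exp (-(K + 1) * (s - a))))
      ((K + 1) * (c * Real.exp (-(K + 1) * (s - a)))) s := by
    intro s
    have := (((((hasDerivAt_id s).sub_const a).const_mul (-(K + 1))).exp).const_mul c).neg
    exact this.congr_deriv (by simp only [id]; ring)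
  have key := lt_barrier_of_contact (x := fun s => -y s) (v := 0)
    (x' := fun s => -undelayedField r f g (y s)) (a := a) (b := b)
    (fun s _ => (hd s).neg.continuousAt.continuousWithinAt)
    (fun s _ => (hder s).continuousAt.continuousWithinAt)
    (fun s _ => (hd s).neg) (fun s _ => hder s) (fun j => by simpa using hca j)
    (fun s hs hle j hj => ?_) b ⟨hab, le_rfl⟩ i
  · have : 0 < c * Real.exp (-(K + 1) * (b - a)) := by positivity
    simp only [Pi.neg_apply, Pi.zero_apply, zero_add, neg_lt_neg_iff] at key
    linarith
  · set μ := c * Real.exp (-(K + 1) * (s - a)) with hμdef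
    have hμ : 0 < μ := by positivity
    have hμη : μ ≤ η := by
      refine le_trans ?_ hcη
      refine mul_le_of_le_one_right hc.le (Real.exp_le_one_iff.2 ?_)
      exact mul_nonpos_of_nonpos_of_nonneg (by linarith) (by linarith [hs.1])
    have h1 : undelayedField r f g (fun j => (0 : Fin n → ℝ) j + μ) j
        ≤ undelayedField r f g (y s) j := by
      refine S.field_mono (fun k => ?_) ?_
      · have := hle s ⟨hs.1.le, le_rfl⟩ k
        simp only [Pi.neg_apply, Pi.zero_apply, zero_add, neg_le_neg_iff] at this ⊢
        exact this
      · simp only [Pi.neg_apply, Pi.zero_apply, zero_add, neg_inj] at hj ⊢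
        exact hj.symm
    have h3 := (abs_le.1 (hb μ (by rwa [abs_of_pos hμ]) j)).1
    rw [abs_of_pos hμ, h_eq] at h3
    simp only [Pi.neg_apply, Pi.zero_apply] at h1 h3 ⊢
    linarith

/-- The running minimum of an entire solution coming from `+∞` consists of vectors at which the
undelayed field is nonpositive. -/
theorem IsMonotoneDelaySystem.exists_running_min (S : IsMonotoneDelaySystem r f g)
    (hy : IsEntireUndelayedSolution r f g y)
    (hy_bot : ∀ i, Tendsto (fun t => y t i) atBot atTop) (s : ℝ) :
    ∃ v : Fin n → ℝ, (∀ i, undelayedField r f g v i ≤ 0) ∧ v ≤ y s ∧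
      ∀ i, ∃ σ ≤ s, v i = y σ i := by
  have hd := S.hasDerivAt_undelayed hy
  have hmin : ∀ i, ∃ σ ≤ s, ∀ τ ≤ s, y σ i ≤ y τ i := by
    intro i
    have hc : Continuous fun t => y t i :=
      continuous_iff_continuousAt.2 fun t => (hasDerivAt_pi.1 (hd t) i).continuousAt
    -- Because y_i → ∞ at -∞, the minimum over the half-line is attained on a compact interval
    -- ending at s.
    obtain ⟨a, ha⟩ := eventually_atBot.1 ((hy_bot i).eventually_ge_atTop (y s i))
    obtain ⟨σ, hσ, hmin⟩ := isCompact_Icc.exists_isMinOn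
      (nonempty_Icc.2 (min_le_right a s)) hc.continuousOn
    refine ⟨σ, hσ.2, fun τ hτ => ?_⟩
    rcases le_total τ (min a s) with h | h
    · exact (hmin ⟨min_le_right a s, le_rfl⟩).trans (ha τ (h.trans (min_le_left a s)))
    · exact hmin ⟨h, hτ⟩
  choose σ hσ hle using hmin
  refine ⟨fun i => y (σ i) i, fun i => ?_, fun i => hle i s le_rfl, fun i => ⟨σ i, hσ i, rfl⟩⟩
  -- The minimising times differ between coordinates, but v ≤ y(σ_i) holds in all of them, with
  -- equality in the i-th.
  have h1 : undelayedField r f g (fun i => y (σ i) i) i ≤ undelayedField r f g (y (σ i)) i :=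
    S.field_mono (fun j => hle j _ (hσ i)) rfl
  refine h1.trans ((hasDerivAt_pi.1 (hd (σ i)) i).nonpos_of_left_ge (sub_one_lt (σ i))
    fun τ hτ => hle i τ (hτ.2.le.trans (hσ i)))

end Undelayed

/-! ### Large and small invariant boxes; stability. -/

namespace IsMonotoneDelaySystem

variable {n : ℕ} {r : ℝ} {f : (Fin n → ℝ) → (Fin n → ℝ)} {g : ℝ → History n r → (Fin n → ℝ)}
  {y : ℝ → Fin n → ℝ}

theorem exists_large_field_nonpos (S : IsMonotoneDelaySystem r f g)
    (hy : IsEntireUndelayedSolution r f g y)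
    (hy_bot : ∀ i, Tendsto (fun t => y t i) atBot atTop) (R : ℝ) :
    ∃ v : Fin n → ℝ, (∀ i, undelayedField r f g v i ≤ 0) ∧ ∀ i, R ≤ v i := by
  obtain ⟨s, hs⟩ := eventually_atBot.1
    (eventually_all.2 fun i => (hy_bot i).eventually_ge_atTop R)
  obtain ⟨v, hv, -, hσ⟩ := S.exists_running_min hy hy_bot s
  refine ⟨v, hv, fun i => ?_⟩
  obtain ⟨σ, hσs, hvσ⟩ := hσ i
  exact hvσ ▸ hs σ hσs i

theorem exists_small_field_nonpos (S : IsMonotoneDelaySystem r f g)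
    (h_eq : undelayedField r f g 0 = 0) (hy : IsEntireUndelayedSolution r f g y)
    (hy_bot : ∀ i, Tendsto (fun t => y t i) atBot atTop)
    (hy_top : ∀ i, Tendsto (fun t => y t i) atTop (𝓝 0)) {ε : ℝ} (hε : 0 < ε) :
    ∃ v : Fin n → ℝ, (∀ i, undelayedField r f g v i ≤ 0) ∧ ∀ i, 0 < v i ∧ v i < ε := by
  obtain ⟨a, ha⟩ := eventually_atBot.1
    (eventually_all.2 fun i => (hy_bot i).eventually_gt_atTop 0)
  have hpos : ∀ t i, 0 < y t i := fun t i => by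
    rcases le_total t a with h | h
    · exact ha t h i
    · exact S.undelayed_pos h_eq hy h (ha a le_rfl) i
  obtain ⟨s, hs⟩ := (eventually_all.2 fun i => (hy_top i).eventually_lt_const hε).exists
  obtain ⟨v, hv, hvs, hσ⟩ := S.exists_running_min hy hy_bot s
  refine ⟨v, hv, fun i => ⟨?_, (hvs i).trans_lt (hs i)⟩⟩
  obtain ⟨σ, -, hvσ⟩ := hσ i
  exact hvσ ▸ hpos σ i

/-- Every history lies below a nonnegative constant at which the undelayed field is nonpositive. -/
theorem exists_upper_bound (S : IsMonotoneDelaySystem r f g)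
    (hy : IsEntireUndelayedSolution r f g y)
    (hy_bot : ∀ i, Tendsto (fun t => y t i) atBot atTop) (φ : History n r) :
    ∃ v : Fin n → ℝ, 0 ≤ v ∧ (∀ i, undelayedField r f g v i ≤ 0) ∧ φ ≤ constHistory r v := by
  obtain ⟨v, hv, hR⟩ := S.exists_large_field_nonpos hy hy_bot ‖φ‖
  refine ⟨v, fun i => (norm_nonneg φ).trans (hR i), hv, fun θ i => ?_⟩
  exact (le_abs_self _).trans (((norm_le_pi_norm (φ θ) i).trans (φ.norm_coe_le_norm θ)).trans (hR i))

/-- The box [0, v] with 0 < v_i < ε is invariant, and any δ below all the v_i puts the initial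
history inside it. -/
theorem isStableOnCone (S : IsMonotoneDelaySystem r f g)
    (h_eq : undelayedField r f g 0 = 0) (hy : IsEntireUndelayedSolution r f g y)
    (hy_bot : ∀ i, Tendsto (fun t => y t i) atBot atTop)
    (hy_top : ∀ i, Tendsto (fun t => y t i) atTop (𝓝 0)) : IsStableOnCone r f g := by
  intro t₀ ht₀ ε hε
  obtain ⟨v, hv, hvε⟩ := S.exists_small_field_nonpos h_eq hy hy_bot hy_top hε
  obtain ⟨δ, hδ, hδv⟩ : ∃ δ > 0, ∀ i, δ < v i := by
    have : ∀ᶠ δ in 𝓝[>] (0 : ℝ), δ ∈ Ioi 0 ∧ ∀ i, δ < v i :=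
      Filter.Eventually.and self_mem_nhdsWithin (eventually_all.2 fun i =>
        mem_of_superset (Ioo_mem_nhdsGT (hvε i).1) fun c hc => hc.2)
    exact this.exists
  refine ⟨δ, hδ, fun T x hx h0 hxδ t ht htT => ?_⟩
  have hupper : segment_at r x t ≤ constHistory r v := by
    refine hx.le_of_field_nonpos S ht₀ hv (fun θ i => ?_) ht htT
    exact (le_abs_self _).trans (((norm_le_pi_norm (segment_at r x t₀ θ) i).trans
      ((segment_at r x t₀).norm_coe_le_norm θ)).trans (hxδ.le.trans (hδv i).le))
  have hlower : constHistory r 0 ≤ segment_at r x t :=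
    hx.ge_of_field_nonneg S ht₀ (fun i => by rw [h_eq]; rfl) h0 ht htT
  refine ⟨hlower, (ContinuousMap.norm_lt_iff _ hε).2 fun θ => (pi_norm_lt_iff hε).2 fun i => ?_⟩
  have h1 : segment_at r x t θ i ≤ v i := hupper θ i
  have h2 : 0 ≤ segment_at r x t θ i := hlower θ i
  rw [Real.norm_of_nonneg h2]
  exact h1.trans_lt (hvε i).2

end IsMonotoneDelaySystem

/-! ### Global attractivity. -/

/-- A function decreasing at a definite rate as long as it is above `c` is eventually at most `c`. -/
theorem eventually_le_of_hasDerivAt_le_neg {u u' : ℝ → ℝ} {a c η : ℝ} (hη : 0 < η)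
    (hu : ∀ t, a ≤ t → HasDerivAt u (u' t) t) (hc : ∀ t, a ≤ t → c ≤ u t → u' t ≤ -η) :
    ∀ᶠ t in atTop, u t ≤ c := by
  obtain ⟨b, hab, hb⟩ : ∃ b ≥ a, u b ≤ c := by
    by_contra! hcon
    have hlin : ∀ t, a ≤ t → u t ≤ u a - η * (t - a) := by
      intro t ht
      have hB : ∀ s, HasDerivAt (fun s => u a - η * (s - a)) (-η) s := fun s => by
        have := (((hasDerivAt_id s).sub_const a).const_mul η).const_sub (u a)
        exact this.congr_deriv (by simp)
      exact image_le_of_deriv_right_le_deriv_boundary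
        (fun s hs => (hu s hs.1).continuousAt.continuousWithinAt)
        (fun s hs => (hu s hs.1).hasDerivWithinAt) (by simp)
        (fun s _ => (hB s).continuousAt.continuousWithinAt)
        (fun s _ => (hB s).hasDerivWithinAt)
        (fun s hs => hc s hs.1 (hcon s hs.1).le) ⟨ht, le_rfl⟩
    have hq : 0 ≤ (u a - c) / η := div_nonneg (sub_nonneg.2 (hcon a le_rfl).le) hη.le
    have h1 := hlin (a + (u a - c) / η) (by linarith)
    have h2 := hcon (a + (u a - c) / η) (by linarith)
    rw [add_sub_cancel_left, mul_div_cancel₀ _ hη.ne'] at h1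
    linarith
  filter_upwards [eventually_ge_atTop b] with t ht
  exact image_le_of_deriv_right_lt_deriv_boundary (B := fun _ => c) (B' := fun _ => 0)
    (fun s hs => (hu s (hab.trans hs.1)).continuousAt.continuousWithinAt)
    (fun s hs => (hu s (hab.trans hs.1)).hasDerivWithinAt) hb (fun s => hasDerivAt_const s c)
    (fun s hs hsc => (hc s (hab.trans hs.1) hsc.ge).trans_lt (neg_lt_zero.2 hη)) ⟨ht, le_rfl⟩

namespace IsDelayedSolution

variable {n : ℕ} {r : ℝ} {f : (Fin n → ℝ) → (Fin n → ℝ)} {g : ℝ → History n r → (Fin n → ℝ)}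
  {t₀ : ℝ} {x : ℝ → Fin n → ℝ}

/-- The vector of upper limits of a bounded solution is a vector at which the undelayed field is
nonnegative. -/
theorem field_limsup_nonneg (S : IsMonotoneDelaySystem r f g) (hx : IsDelayedSolution r f g t₀ ⊤ x)
    (ht₀ : 0 ≤ t₀) (hu : ∀ i, IsBoundedUnder (· ≤ ·) atTop fun t => x t i)
    (hl : ∀ i, IsBoundedUnder (· ≥ ·) atTop fun t => x t i) (i : Fin n) :
    0 ≤ undelayedField r f g (fun i => limsup (fun t => x t i) atTop) i := by
  set M : Fin n → ℝ := fun i => limsup (fun t => x t i) atTop with hM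
  have hr := S.r_nonneg
  by_contra! hneg
  -- P(ε, ξ) bounds the velocity of coordinate i when it currently equals ξ and the whole segment
  -- lies below M + ε𝟙. Only f needs the current value kept separate, being merely quasimonotone. If
  -- F_i(M) < 0, then P stays below F_i(M)/2 near (0, M_i).
  let P : ℝ × ℝ → ℝ := fun p =>
    f (Function.update (fun j => M j + p.1) i p.2) i + g 0 (constHistory r fun j => M j + p.1) i
  have hPc : Continuous P := by
    have h1 : Continuous fun p : ℝ × ℝ => Function.update (fun j => M j + p.1) i p.2 :=
      Continuous.update (by fun_prop) i continuous_snd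
    have h2 : Continuous fun p : ℝ × ℝ => constHistory r fun j => M j + p.1 :=
      (lipschitzWith_constHistory n r).continuous.comp (by fun_prop)
    exact ((continuous_apply i).comp (S.f_lip.continuous.comp h1)).add
      ((continuous_apply i).comp ((S.g_lip 0 le_rfl).continuous.comp h2))
  have hP0 : P (0, M i) = undelayedField r f g M i := by
    simp [P, undelayedField]
  obtain ⟨ε, hε, hPε⟩ := Metric.nhds_basis_closedBall.mem_iff.1
    (hPc.continuousAt.eventually_lt_const (u := undelayedField r f g M i / 2)
      (by rw [hP0]; linarith : P (0, M i) < _))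
  have hev : ∀ᶠ t in atTop, ∀ j, x t j < M j + ε := eventually_all.2 fun j =>
    eventually_lt_of_limsup_lt (by simp only [hM]; linarith) (hu j)
  obtain ⟨t₁, ht₁⟩ := eventually_atTop.1 hev
  have hfin : ∀ᶠ t in atTop, x t i ≤ M i - ε := by
    -- The shift by r puts the whole segment past t₁; the shift by 1 makes t > t₀, where the
    -- derivative is two-sided.
    refine eventually_le_of_hasDerivAt_le_neg (a := max (t₁ + r) (t₀ + 1))
      (η := -(undelayedField r f g M i / 2))
      (u' := fun t => (f (x t) + g t (segment_at r x t)) i) (by linarith)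
      (fun t ht => hasDerivAt_pi.1 (hx.hasDerivAt
        (by linarith [(le_max_right _ _).trans ht]) (EReal.coe_lt_top t)) i) fun t ht hxt => ?_
    have h1 : t₁ + r ≤ t := (le_max_left _ _).trans ht
    have h2 : t₀ + 1 ≤ t := (le_max_right _ _).trans ht
    have hle : ∀ s ∈ Icc (t - r) t, x s ≤ fun j => M j + ε := fun s hs j =>
      (ht₁ s (by linarith [hs.1]) j).le
    have h3 : f (x t) i ≤ f (Function.update (fun j => M j + ε) i (x t i)) i := by
      refine S.f_mono _ _ (fun j => ?_) i (by simp)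
      rcases eq_or_ne j i with rfl | hj
      · simp
      · simpa [hj] using hle t ⟨by linarith, le_rfl⟩ j
    have h4 : g t (segment_at r x t) i ≤ g 0 (constHistory r fun j => M j + ε) i := by
      rw [← S.g_const _ t (by linarith)]
      exact S.g_mono t (by linarith) _ _ ((segment_at_le_constHistory_iff
        (hx.continuousOn_Icc (by linarith) (EReal.coe_lt_top t)) _).2 hle) i
    have h5 : P (ε, x t i) < undelayedField r f g M i / 2 := by
      apply hPε
      have h6 : x t i ≤ M i + ε := hle t ⟨by linarith, le_rfl⟩ i
      rw [Metric.mem_closedBall, Prod.dist_eq, max_le_iff]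
      refine ⟨by simp [abs_of_pos hε], ?_⟩
      rw [Real.dist_eq, abs_le]
      constructor <;> linarith
    simp only [P] at h5
    simp only [Pi.add_apply, neg_neg]
    linarith
  have : M i ≤ M i - ε := limsup_le_of_le (hl i).isCoboundedUnder_le hfin
  linarith

theorem tendsto_zero (S : IsMonotoneDelaySystem r f g)
    (h_eq : undelayedField r f g 0 = 0) {y : ℝ → Fin n → ℝ} (hy : IsEntireUndelayedSolution r f g y)
    (hy_bot : ∀ i, Tendsto (fun t => y t i) atBot atTop)
    (hy_top : ∀ i, Tendsto (fun t => y t i) atTop (𝓝 0))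
    (hx : IsDelayedSolution r f g t₀ ⊤ x) (ht₀ : 0 ≤ t₀) (h0 : 0 ≤ segment_at r x t₀) :
    Tendsto x atTop (𝓝 0) := by
  have hr := S.r_nonneg
  obtain ⟨v, -, hv, hφ⟩ := S.exists_upper_bound hy hy_bot (segment_at r x t₀)
  have hxv : ∀ t, t₀ ≤ t → 0 ≤ x t ∧ x t ≤ v := fun t ht => by
    have hc := hx.continuousOn_Icc (by linarith) (EReal.coe_lt_top t) (a := t - r)
    exact ⟨(constHistory_le_segment_at_iff hc _).1 (hx.ge_of_field_nonneg S ht₀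
        (fun i => by rw [h_eq]; rfl) h0 ht (EReal.coe_lt_top t)) t ⟨by linarith, le_rfl⟩,
      (segment_at_le_constHistory_iff hc _).1 (hx.le_of_field_nonpos S ht₀ hv hφ ht
        (EReal.coe_lt_top t)) t ⟨by linarith, le_rfl⟩⟩
  have hu : ∀ i, IsBoundedUnder (· ≤ ·) atTop fun t => x t i := fun i =>
    ⟨v i, eventually_map.2 ((eventually_ge_atTop t₀).mono fun t ht => (hxv t ht).2 i)⟩
  have hl : ∀ i, IsBoundedUnder (· ≥ ·) atTop fun t => x t i := fun i =>
    ⟨0, eventually_map.2 ((eventually_ge_atTop t₀).mono fun t ht => (hxv t ht).1 i)⟩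
  have hM := hx.field_limsup_nonneg S ht₀ hu hl
  obtain ⟨s, hs⟩ := (eventually_all.2 fun i => (hy_bot i).eventually_ge_atTop
    (limsup (fun t => x t i) atTop)).exists
  -- M lies below y(s) and F(M) ≥ 0, so M ≤ y(t) for all t ≥ s; let t → ∞.
  have hM0 : ∀ i, limsup (fun t => x t i) atTop ≤ 0 := fun i =>
    ge_of_tendsto (hy_top i) ((eventually_ge_atTop s).mono fun t ht =>
      S.undelayed_ge hy hM ht hs i)
  refine tendsto_pi_nhds.2 fun i => tendsto_order.2 ⟨fun a ha => ?_, fun a ha => ?_⟩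
  · filter_upwards [eventually_ge_atTop t₀] with t ht using lt_of_lt_of_le ha ((hxv t ht).1 i)
  · exact eventually_lt_of_limsup_lt ((hM0 i).trans_lt ha) (hu i)

end IsDelayedSolution

/-! ### Global existence by a monotone fixed point. -/

/-- Knaster–Tarski in a subset closed under suprema of nonempty subsets. -/
theorem exists_fixedPoint_of_isLUB {α : Type*} [PartialOrder α] {A : Set α} {Φ : α → α}
    (hmaps : MapsTo Φ A A) (hmono : MonotoneOn Φ A) (hbot : ∃ x ∈ A, x ≤ Φ x)
    (hsup : ∀ D ⊆ A, D.Nonempty → ∃ z ∈ A, IsLUB D z) : ∃ z ∈ A, Φ z = z := by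
  obtain ⟨x₀, hx₀, hx₀Φ⟩ := hbot
  obtain ⟨z, hz, hlub⟩ := hsup {x ∈ A | x ≤ Φ x} (fun x hx => hx.1) ⟨x₀, hx₀, hx₀Φ⟩
  have h1 : z ≤ Φ z := hlub.2 fun x hx => hx.2.trans (hmono hx.1 hz (hlub.1 hx))
  exact ⟨z, hz, le_antisymm (hlub.1 ⟨hmaps hz, hmono hz (hmaps hz) h1⟩) h1⟩

/-- The solution of `p' = -K p + G`, `p a = c`. -/
noncomputable def dampedIntegral (K c a : ℝ) (G : ℝ → ℝ) (t : ℝ) : ℝ :=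
  Real.exp (-K * (t - a)) * (c + ∫ s in a..t, Real.exp (K * (s - a)) * G s)

section dampedIntegral

variable {K c a : ℝ} {G : ℝ → ℝ}

theorem dampedIntegral_self : dampedIntegral K c a G a = c := by
  simp [dampedIntegral]

theorem hasDerivAt_dampedIntegral (hG : Continuous G) (t : ℝ) :
    HasDerivAt (dampedIntegral K c a G) (-K * dampedIntegral K c a G t + G t) t := by
  have hc : Continuous fun s => Real.exp (K * (s - a)) * G s := by fun_prop
  have h1 : HasDerivAt (fun t => c + ∫ s in a..t, Real.exp (K * (s - a)) * G s)
      (Real.exp (K * (t - a)) * G t) t :=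
    (intervalIntegral.integral_hasDerivAt_right (hc.intervalIntegrable _ _)
      (hc.stronglyMeasurableAtFilter _ _) hc.continuousAt).const_add c
  have h2 : HasDerivAt (fun t => Real.exp (-K * (t - a))) (Real.exp (-K * (t - a)) * -K) t :=
    (((hasDerivAt_id t).sub_const a).const_mul (-K)).exp.congr_deriv (by simp)
  refine (h2.mul h1).congr_deriv ?_
  have h3 : Real.exp (-K * (t - a)) * Real.exp (K * (t - a)) = 1 := by
    rw [← Real.exp_add]; simp
  rw [dampedIntegral]
  linear_combination G t * h3

theorem dampedIntegral_mono {G' : ℝ → ℝ} (hG : Continuous G) (hG' : Continuous G')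
    (h : ∀ s, G s ≤ G' s) {t : ℝ} (ht : a ≤ t) :
    dampedIntegral K c a G t ≤ dampedIntegral K c a G' t := by
  refine mul_le_mul_of_nonneg_left (add_le_add_right ?_ _) (Real.exp_pos _).le
  exact intervalIntegral.integral_mono ht
    (Continuous.intervalIntegrable (by fun_prop) _ _)
    (Continuous.intervalIntegrable (by fun_prop) _ _)
    fun s => mul_le_mul_of_nonneg_left (h s) (Real.exp_pos _).le

theorem dampedIntegral_nonneg (hc : 0 ≤ c) (h : ∀ s, 0 ≤ G s) {t : ℝ} (ht : a ≤ t) :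
    0 ≤ dampedIntegral K c a G t :=
  mul_nonneg (Real.exp_pos _).le (add_nonneg hc (intervalIntegral.integral_nonneg ht
    fun s _ => mul_nonneg (Real.exp_pos _).le (h s)))

/-- The constant b solves p' = -K p + K b, so it dominates every solution with smaller forcing and
smaller initial value. -/
theorem dampedIntegral_le {b : ℝ} (hG : Continuous G) (hc : c ≤ b) (h : ∀ s, G s ≤ K * b) {t : ℝ}
    (ht : a ≤ t) : dampedIntegral K c a G t ≤ b := by
  have hd : ∀ s, HasDerivAt (fun s => Real.exp (K * (s - a)) * b)
      (Real.exp (K * (s - a)) * (K * b)) s := fun s => by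
    have := (((hasDerivAt_id s).sub_const a).const_mul K).exp.mul_const b
    exact this.congr_deriv (by simp only [id]; ring)
  have h1 : ∫ s in a..t, Real.exp (K * (s - a)) * G s
      ≤ ∫ s in a..t, Real.exp (K * (s - a)) * (K * b) :=
    intervalIntegral.integral_mono ht (Continuous.intervalIntegrable (by fun_prop) _ _)
      (Continuous.intervalIntegrable (by fun_prop) _ _)
      fun s => mul_le_mul_of_nonneg_left (h s) (Real.exp_pos _).le
  rw [intervalIntegral.integral_eq_sub_of_hasDerivAt (fun s _ => hd s)
    (Continuous.intervalIntegrable (by fun_prop) _ _)] at h1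
  simp only [sub_self, mul_zero, Real.exp_zero, one_mul] at h1
  have h3 : Real.exp (-K * (t - a)) * Real.exp (K * (t - a)) = 1 := by
    rw [← Real.exp_add]; simp
  calc dampedIntegral K c a G t ≤ Real.exp (-K * (t - a)) * (Real.exp (K * (t - a)) * b) :=
        mul_le_mul_of_nonneg_left (by linarith) (Real.exp_pos _).le
    _ = b := by rw [← mul_assoc, h3, one_mul]

/-- Both K p and G lie in [0, K b], hence so does the absolute value of their difference p'. -/
theorem abs_dampedIntegral_sub_le {b : ℝ} (hG : Continuous G) (hK : 0 ≤ K) (hc₀ : 0 ≤ c)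
    (hc : c ≤ b) (h₀ : ∀ s, 0 ≤ G s) (h : ∀ s, G s ≤ K * b) {s t : ℝ} (hs : a ≤ s) (ht : a ≤ t) :
    |dampedIntegral K c a G t - dampedIntegral K c a G s| ≤ K * b * |t - s| := by
  refine Convex.norm_image_sub_le_of_norm_hasDerivWithin_le (𝕜 := ℝ)
    (fun u _ => (hasDerivAt_dampedIntegral hG u).hasDerivWithinAt) (fun u hu => ?_)
    (convex_Ici a) hs ht
  have h1 := mul_nonneg hK (dampedIntegral_nonneg (K := K) hc₀ h₀ hu)
  have h2 := mul_le_mul_of_nonneg_left (dampedIntegral_le hG hc h hu) hK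
  rw [Real.norm_eq_abs, abs_le]
  constructor <;> linarith [h₀ u, h u]

end dampedIntegral

/-- The history `φ` placed on `[a - r, a]` and extended by constants. -/
noncomputable def pastExtension {n : ℕ} {r : ℝ} (hr : 0 ≤ r) (φ : History n r) (a t : ℝ) :
    Fin n → ℝ :=
  φ (projIcc (-r) 0 (neg_nonpos.2 hr) (t - a))

section pastExtension

variable {n : ℕ} {r : ℝ} {hr : 0 ≤ r} {φ : History n r} {a : ℝ}

theorem continuous_pastExtension : Continuous (pastExtension hr φ a) :=
  φ.continuous.comp (continuous_projIcc.comp (by fun_prop))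

theorem pastExtension_of_ge {t : ℝ} (ht : a ≤ t) :
    pastExtension hr φ a t = pastExtension hr φ a a := by
  unfold pastExtension
  rw [projIcc_of_right_le _ (sub_nonneg.2 ht), projIcc_of_right_le _ (sub_self a).ge]

theorem segment_at_of_eqOn_pastExtension {x : ℝ → Fin n → ℝ}
    (hx : ∀ t ∈ Icc (a - r) a, x t = pastExtension hr φ a t) : segment_at r x a = φ := by
  rw [segment_at_congr hx]
  ext1 θ
  rw [segment_at_apply continuous_pastExtension.continuousOn, pastExtension, add_sub_cancel_left,
    projIcc_val]

theorem pastExtension_segment_at {x : ℝ → Fin n → ℝ} (hx : ContinuousOn x (Icc (a - r) a)) {t : ℝ}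
    (ht : t ∈ Icc (a - r) a) : pastExtension hr (segment_at r x a) a t = x t := by
  have h : t - a ∈ Icc (-r) 0 := ⟨by linarith [ht.1], by linarith [ht.2]⟩
  rw [pastExtension, segment_at_apply hx, projIcc_of_mem _ h]
  simp

end pastExtension

/-- The map t ↦ x_t is the currying of the continuous map (t, θ) ↦ x(t + θ). -/
theorem continuous_segment_at {n : ℕ} {r : ℝ} {x : ℝ → Fin n → ℝ} (hx : Continuous x) :
    Continuous (segment_at r x) := by
  let F : C(ℝ × Icc (-r) (0 : ℝ), Fin n → ℝ) := ⟨fun p => x (p.1 + p.2), by fun_prop⟩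
  have : segment_at r x = F.curry := by
    funext t
    ext1 θ
    rw [segment_at_apply hx.continuousOn]
    rfl
  rw [this]
  exact F.curry.continuous

namespace IsMonotoneDelaySystem

variable {n : ℕ} {r : ℝ} {f : (Fin n → ℝ) → (Fin n → ℝ)} {g : ℝ → History n r → (Fin n → ℝ)}

/-- Monotonicity upgrades separate continuity to joint continuity. -/
theorem continuous_comp (S : IsMonotoneDelaySystem r f g) {c : ℝ → History n r}
    (hc : Continuous c) : Continuous fun t => g (max t 0) (c t) := by
  have hgt : ∀ φ, Continuous fun t => g (max t 0) φ := fun φ =>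
    (S.g_cont φ).comp_continuous (by fun_prop) fun t => le_max_right t 0
  have hgφ : ∀ t, Continuous (g (max t 0)) := fun t => (S.g_lip _ (le_max_right t 0)).continuous
  have hshift : Continuous fun μ : ℝ => constHistory r (fun _ : Fin n => μ) :=
    (lipschitzWith_constHistory n r).continuous.comp (by fun_prop)
  have hzero : constHistory r (fun _ : Fin n => (0 : ℝ)) = 0 := rfl
  -- Sup-norm closeness is an order sandwich between shifts by constants. It traps g(s, c s) between
  -- values at fixed histories, where continuity in time alone suffices.
  have hball : ∀ t, ∀ δ > 0, ∀ᶠ s in 𝓝 t,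
      c t - constHistory r (fun _ => δ) ≤ c s ∧ c s ≤ c t + constHistory r (fun _ => δ) := by
    intro t δ hδ
    filter_upwards [hc.continuousAt (Metric.closedBall_mem_nhds _ hδ)] with s hs
    have h1 : ∀ θ i, |c s θ i - c t θ i| ≤ δ := fun θ i => by
      rw [← Real.dist_eq]
      exact (dist_le_pi_dist _ _ i).trans ((ContinuousMap.dist_apply_le_dist θ).trans hs)
    refine ⟨fun θ i => ?_, fun θ i => ?_⟩
    · have h2 := (abs_le.1 (h1 θ i)).1
      change c t θ i - δ ≤ c s θ i
      linarith
    · have h2 := (abs_le.1 (h1 θ i)).2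
      change c s θ i ≤ c t θ i + δ
      linarith
  refine continuous_iff_continuousAt.2 fun t => tendsto_pi_nhds.2 fun i =>
    tendsto_order.2 ⟨fun a ha => ?_, fun a ha => ?_⟩
  · have h1 : Tendsto (fun μ : ℝ => g (max t 0) (c t - constHistory r (fun _ => μ)) i) (𝓝[>] 0)
        (𝓝 (g (max t 0) (c t) i)) := by
      have hsh : Continuous fun μ : ℝ => c t - constHistory r (fun _ => μ) :=
        continuous_const.sub hshift
      have := ((continuous_apply i).comp ((hgφ t).comp hsh)).tendsto 0
      simp only [Function.comp_def] at this
      rw [hzero, sub_zero] at this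
      exact this.mono_left nhdsWithin_le_nhds
    obtain ⟨δ, hδa, hδ⟩ := ((h1.eventually_const_lt ha).and self_mem_nhdsWithin).exists
    filter_upwards [((continuous_apply i).comp (hgt _)).continuousAt.eventually_const_lt hδa,
      hball t δ hδ] with s hs1 hs2
    exact hs1.trans_le (S.g_mono _ (le_max_right s 0) _ _ hs2.1 i)
  · have h1 : Tendsto (fun μ : ℝ => g (max t 0) (c t + constHistory r (fun _ => μ)) i) (𝓝[>] 0)
        (𝓝 (g (max t 0) (c t) i)) := by
      have hsh : Continuous fun μ : ℝ => c t + constHistory r (fun _ => μ) :=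
        continuous_const.add hshift
      have := ((continuous_apply i).comp ((hgφ t).comp hsh)).tendsto 0
      simp only [Function.comp_def] at this
      rw [hzero, add_zero] at this
      exact this.mono_left nhdsWithin_le_nhds
    obtain ⟨δ, hδa, hδ⟩ := ((h1.eventually_lt_const ha).and self_mem_nhdsWithin).exists
    filter_upwards [((continuous_apply i).comp (hgt _)).continuousAt.eventually_lt_const hδa,
      hball t δ hδ] with s hs1 hs2
    exact (S.g_mono _ (le_max_right s 0) _ _ hs2.2 i).trans_lt hs1

theorem continuous_rhs (S : IsMonotoneDelaySystem r f g) {x : ℝ → Fin n → ℝ} (hx : Continuous x) :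
    Continuous fun t => f (x t) + g (max t 0) (segment_at r x t) :=
  (S.f_lip.continuous.comp hx).add (S.continuous_comp (continuous_segment_at hx))

end IsMonotoneDelaySystem

/-- Continuous functions with prescribed past, with values in `[0, v]`, and Lipschitz after time `a`
(the past being compensated by subtracting its extension by a constant). -/
def lipschitzInterval {n : ℕ} {r : ℝ} (hr : 0 ≤ r) (φ : History n r) (a : ℝ) (v : Fin n → ℝ)
    (K : ℝ) : Set (ℝ → Fin n → ℝ) :=
  {x | (∀ t, 0 ≤ x t ∧ x t ≤ v) ∧ (∀ t ≤ a, x t = pastExtension hr φ a t) ∧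
    ∀ i s t, x t i - pastExtension hr φ a t i ≤
      x s i - pastExtension hr φ a s i + K * v i * dist t s}

section lipschitzInterval

variable {n : ℕ} {r : ℝ} {hr : 0 ≤ r} {φ : History n r} {a : ℝ} {v : Fin n → ℝ} {K : ℝ}

theorem continuous_of_mem_lipschitzInterval (hK : 0 ≤ K) (hv : 0 ≤ v) {x : ℝ → Fin n → ℝ}
    (hx : x ∈ lipschitzInterval hr φ a v K) : Continuous x := by
  refine continuous_pi fun i => ?_
  have h1 : Continuous fun t => x t i - pastExtension hr φ a t i :=
    (LipschitzWith.of_le_add_mul ⟨K * v i, mul_nonneg hK (hv i)⟩ fun t s => hx.2.2 i s t).continuous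
  have h2 : Continuous fun t => pastExtension hr φ a t i :=
    (continuous_apply i).comp (continuous_pastExtension (hr := hr))
  exact (h1.add h2).congr fun t => by simp

/-- The supremum is taken pointwise; the common Lipschitz bound survives it, so the supremum is not
lost to discontinuity. -/
theorem exists_isLUB_lipschitzInterval (D : Set (ℝ → Fin n → ℝ))
    (hD : D ⊆ lipschitzInterval hr φ a v K) (hne : D.Nonempty) :
    ∃ z ∈ lipschitzInterval hr φ a v K, IsLUB D z := by
  let z : ℝ → Fin n → ℝ := fun t i => sSup ((fun x => x t i) '' D)
  have hneI : ∀ t i, ((fun x : ℝ → Fin n → ℝ => x t i) '' D).Nonempty := fun t i => hne.image _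
  have hbdd : ∀ t i, BddAbove ((fun x : ℝ → Fin n → ℝ => x t i) '' D) := fun t i =>
    ⟨v i, forall_mem_image.2 fun x hx => ((hD hx).1 t).2 i⟩
  have hub : ∀ x ∈ D, x ≤ z := fun x hx t i => le_csSup (hbdd t i) (mem_image_of_mem _ hx)
  have hlub : ∀ t i b, (∀ x ∈ D, x t i ≤ b) → z t i ≤ b := fun t i b h =>
    csSup_le (hneI t i) (forall_mem_image.2 h)
  obtain ⟨x₀, hx₀⟩ := hne
  refine ⟨z, ⟨fun t => ⟨fun i => (((hD hx₀).1 t).1 i).trans (hub x₀ hx₀ t i), fun i =>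
    hlub t i _ fun x hx => ((hD hx).1 t).2 i⟩, fun t ht => ?_, fun i s t => ?_⟩,
    fun x hx => hub x hx, fun w hw t i => hlub t i _ fun x hx => hw hx t i⟩
  · funext i
    refine le_antisymm (hlub t i _ fun x hx => by rw [(hD hx).2.1 t ht]) ?_
    rw [← (hD hx₀).2.1 t ht]
    exact hub x₀ hx₀ t i
  · rw [sub_le_iff_le_add]
    refine hlub t i _ fun x hx => ?_
    have h1 := (hD hx).2.2 i s t
    have h2 := hub x hx s i
    linarith

/-- The solution of `x' = -K x + G` with past `φ`. -/
noncomputable def dampedExtension {n : ℕ} {r : ℝ} (hr : 0 ≤ r) (φ : History n r) (a K : ℝ)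
    (G : ℝ → Fin n → ℝ) (t : ℝ) : Fin n → ℝ := fun i =>
  pastExtension hr φ a t i + (dampedIntegral K (pastExtension hr φ a a i) a (fun s => G s i) (max t a)
    - pastExtension hr φ a a i)

theorem dampedExtension_of_le {G : ℝ → Fin n → ℝ} {t : ℝ} (ht : t ≤ a) :
    dampedExtension hr φ a K G t = pastExtension hr φ a t := by
  funext i
  rw [dampedExtension, max_eq_right ht, dampedIntegral_self, sub_self, add_zero]

theorem dampedExtension_of_ge {G : ℝ → Fin n → ℝ} {t : ℝ} (ht : a ≤ t) (i : Fin n) :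
    dampedExtension hr φ a K G t i =
      dampedIntegral K (pastExtension hr φ a a i) a (fun s => G s i) t := by
  rw [dampedExtension, max_eq_left ht, pastExtension_of_ge ht, add_sub_cancel]

theorem dampedExtension_mem_lipschitzInterval (hK : 0 ≤ K) (hφ : 0 ≤ φ)
    (hφv : φ ≤ constHistory r v) {G : ℝ → Fin n → ℝ} (hG : Continuous G) (hG₀ : ∀ s, 0 ≤ G s)
    (hGv : ∀ s i, G s i ≤ K * v i) :
    dampedExtension hr φ a K G ∈ lipschitzInterval hr φ a v K := by
  have hp₀ : ∀ t i, 0 ≤ pastExtension hr φ a t i := fun t i => hφ _ i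
  have hpv : ∀ t i, pastExtension hr φ a t i ≤ v i := fun t i => hφv _ i
  have hGi : ∀ i, Continuous fun s => G s i := fun i => (continuous_apply i).comp hG
  have hbd : ∀ t i, 0 ≤ dampedExtension hr φ a K G t i ∧ dampedExtension hr φ a K G t i ≤ v i := by
    intro t i
    rcases le_total t a with h | h
    · rw [dampedExtension_of_le h]
      exact ⟨hp₀ t i, hpv t i⟩
    · rw [dampedExtension_of_ge h]
      exact ⟨dampedIntegral_nonneg (hp₀ a i) (fun s => hG₀ s i) h,
        dampedIntegral_le (hGi i) (hpv a i) (fun s => hGv s i) h⟩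
  refine ⟨fun t => ⟨fun i => (hbd t i).1, fun i => (hbd t i).2⟩, fun t ht =>
    dampedExtension_of_le ht, fun i s t => ?_⟩
  have h1 := (abs_le.1 (abs_dampedIntegral_sub_le (hGi i) hK (hp₀ a i) (hpv a i)
    (fun s => hG₀ s i) (fun s => hGv s i) (le_max_right s a) (le_max_right t a))).2
  have h2 : |max t a - max s a| ≤ dist t s := by
    rw [Real.dist_eq]
    simpa using abs_max_sub_max_le_abs t s a
  have h3 := mul_le_mul_of_nonneg_left h2 (mul_nonneg hK ((hp₀ a i).trans (hpv a i)))
  simp only [dampedExtension]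
  linarith

end lipschitzInterval

/-- Global existence, with the solution continuous on the whole line. -/
theorem IsMonotoneDelaySystem.exists_solution {n : ℕ} {r : ℝ} {f : (Fin n → ℝ) → (Fin n → ℝ)}
    {g : ℝ → History n r → (Fin n → ℝ)} (S : IsMonotoneDelaySystem r f g)
    (h_eq : undelayedField r f g 0 = 0) {v : Fin n → ℝ} (hv : 0 ≤ v)
    (hvf : ∀ i, undelayedField r f g v i ≤ 0) {φ : History n r} (hφ : 0 ≤ φ)
    (hφv : φ ≤ constHistory r v) {a : ℝ} (ha : 0 ≤ a) :
    ∃ x : ℝ → Fin n → ℝ, Continuous x ∧ IsDelayedSolution r f g a ⊤ x ∧ segment_at r x a = φ := by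
  have hr := S.r_nonneg
  -- With K a Lipschitz constant of f on the box, f + K·id is fully monotone there: lower the other
  -- coordinates by quasimonotonicity, then coordinate i at a cost absorbed by K.
  obtain ⟨K, hKL⟩ := (S.f_lip.locallyLipschitzOn (s := Icc 0 v)).exists_lipschitzOnWith_of_compact
    isCompact_Icc
  have hK : (0 : ℝ) ≤ K := K.2
  have hfK : ∀ u w : Fin n → ℝ, 0 ≤ u → u ≤ w → w ≤ v → ∀ i, f u i + K * u i ≤ f w i + K * w i := by
    intro u w hu huw hwv i
    have h1 : f u i ≤ f (Function.update w i (u i)) i := by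
      refine S.f_mono _ _ (fun j => ?_) i (by simp)
      rcases eq_or_ne j i with rfl | hj
      · simp
      · simpa [hj] using huw j
    have hmem : Function.update w i (u i) ∈ Icc 0 v := by
      constructor <;> intro j <;> rcases eq_or_ne j i with rfl | hj
      · simpa using hu j
      · simpa [hj] using (hu j).trans (huw j)
      · simpa using (huw j).trans (hwv j)
      · simpa [hj] using hwv j
    have h2 := (dist_le_pi_dist _ _ i).trans
      (hKL.dist_le_mul _ hmem w ⟨hu.trans huw, hwv⟩)
    have h3 : dist (Function.update w i (u i)) w ≤ w i - u i := by
      refine (dist_pi_le_iff (sub_nonneg.2 (huw i))).2 fun j => ?_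
      rcases eq_or_ne j i with rfl | hj
      · rw [Function.update_self, dist_comm, Real.dist_eq, abs_of_nonneg (sub_nonneg.2 (huw j))]
      · simpa [hj] using huw i
    have h4 := mul_le_mul_of_nonneg_left h3 hK
    rw [Real.dist_eq] at h2
    have h5 := (abs_le.1 (h2.trans h4)).2
    linarith
  -- The equation becomes x' = -K x + G(x) with G monotone. Truncating time at 0 makes G continuous
  -- on the whole line.
  let G : (ℝ → Fin n → ℝ) → ℝ → Fin n → ℝ := fun x t =>
    (f (x t) + g (max t 0) (segment_at r x t)) + (K : ℝ) • x t
  have hGc : ∀ x, Continuous x → Continuous (G x) := fun x hx => by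
    have := S.continuous_rhs hx
    fun_prop
  have hGmono : ∀ x z : ℝ → Fin n → ℝ, Continuous x → Continuous z → (∀ t, 0 ≤ x t) →
      (∀ t, x t ≤ z t) → (∀ t, z t ≤ v) → ∀ t, G x t ≤ G z t := by
    intro x z hx hz hx0 hxz hzv t i
    have h1 := hfK (x t) (z t) (hx0 t) (hxz t) (hzv t) i
    have h2 := S.g_mono (max t 0) (le_max_right t 0) _ _
      (segment_at_le_segment_at (t := t) hx.continuousOn hz.continuousOn fun s _ => hxz s) i
    simp only [G, Pi.add_apply, Pi.smul_apply, smul_eq_mul]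
    linarith
  have hseg : ∀ (u : Fin n → ℝ) t, segment_at r (fun _ => u) t = constHistory r u := fun u t => by
    ext1 θ
    rw [segment_at_apply continuousOn_const]
    rfl
  have hGconst : ∀ (u : Fin n → ℝ) t, G (fun _ => u) t = undelayedField r f g u + (K : ℝ) • u :=
    fun u t => by simp only [G, hseg, S.g_const u _ (le_max_right t 0), undelayedField]
  set A := lipschitzInterval hr φ a v K with hA
  have hcont : ∀ x ∈ A, Continuous x := fun x hx => continuous_of_mem_lipschitzInterval hK hv hx
  have hG₀ : ∀ x ∈ A, ∀ t, 0 ≤ G x t := fun x hx t => by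
    have := hGmono _ x (continuous_const (y := 0)) (hcont x hx) (fun _ => le_rfl)
      (fun t => (hx.1 t).1) (fun t => (hx.1 t).2) t
    rwa [hGconst, h_eq, smul_zero, add_zero] at this
  have hGv : ∀ x ∈ A, ∀ t i, G x t i ≤ K * v i := fun x hx t i => by
    have := hGmono x _ (hcont x hx) (continuous_const (y := v))
      (fun t => (hx.1 t).1) (fun t => (hx.1 t).2) (fun _ => le_rfl) t i
    rw [hGconst] at this
    simp only [Pi.add_apply, Pi.smul_apply, smul_eq_mul] at this
    linarith [hvf i]
  have hmono : ∀ G₁ G₂ : ℝ → Fin n → ℝ, Continuous G₁ → Continuous G₂ → (∀ t, G₁ t ≤ G₂ t) →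
      dampedExtension hr φ a K G₁ ≤ dampedExtension hr φ a K G₂ := by
    intro G₁ G₂ h₁ h₂ h t i
    have := dampedIntegral_mono (K := K) (c := pastExtension hr φ a a i)
      ((continuous_apply i).comp h₁) ((continuous_apply i).comp h₂) (fun s => h s i)
      (le_max_right t a)
    simp only [dampedExtension]
    exact add_le_add_right (sub_le_sub_right this _) _
  -- Zero forcing gives a point below its image, as G is nonnegative on A.
  have hbot : dampedExtension hr φ a K 0 ∈ A :=
    dampedExtension_mem_lipschitzInterval hK hφ hφv continuous_zero (fun _ => le_rfl)
      fun _ i => mul_nonneg hK (hv i)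
  obtain ⟨x, hxA, hx⟩ := exists_fixedPoint_of_isLUB (A := A)
    (Φ := fun x => dampedExtension hr φ a K (G x))
    (fun x hx => dampedExtension_mem_lipschitzInterval hK hφ hφv (hGc x (hcont x hx)) (hG₀ x hx)
      (hGv x hx))
    (fun x hx z hz hxz => hmono _ _ (hGc x (hcont x hx)) (hGc z (hcont z hz))
      (hGmono x z (hcont x hx) (hcont z hz) (fun t => (hx.1 t).1) hxz fun t => (hz.1 t).2))
    ⟨_, hbot, hmono _ _ continuous_zero (hGc _ (hcont _ hbot)) (hG₀ _ hbot)⟩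
    exists_isLUB_lipschitzInterval
  have hxc := hcont x hxA
  refine ⟨x, hxc, ⟨EReal.coe_lt_top a, hxc.continuousOn, fun t ht _ => ?_⟩,
    segment_at_of_eqOn_pastExtension fun t ht => hxA.2.1 t ht.2⟩
  refine hasDerivWithinAt_pi.2 fun i => ?_
  have hxi : ∀ s ∈ Ici a, x s i =
      dampedIntegral K (pastExtension hr φ a a i) a (fun s => G x s i) s := fun s hs => by
    conv_lhs => rw [← hx]
    exact dampedExtension_of_ge hs i
  refine ((hasDerivAt_dampedIntegral ((continuous_apply i).comp
    (hGc x hxc)) t).hasDerivWithinAt.congr hxi (hxi t ht)).congr_deriv ?_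
  have := hxi t ht
  simp only [Function.comp_def] at this ⊢
  rw [← this]
  simp only [G, max_eq_left (ha.trans ht), Pi.add_apply, Pi.smul_apply, smul_eq_mul]
  ring

/-! ### Continuation of solutions. -/

namespace IsDelayedSolution

variable {n : ℕ} {r : ℝ} {f : (Fin n → ℝ) → (Fin n → ℝ)} {g : ℝ → History n r → (Fin n → ℝ)}
  {t₀ : ℝ} {x : ℝ → Fin n → ℝ}

theorem mem_Icc_of_field_nonpos {T : EReal} (S : IsMonotoneDelaySystem r f g)
    (h_eq : undelayedField r f g 0 = 0) (hx : IsDelayedSolution r f g t₀ T x) (ht₀ : 0 ≤ t₀)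
    {v : Fin n → ℝ} (hvf : ∀ i, undelayedField r f g v i ≤ 0) (h0 : 0 ≤ segment_at r x t₀)
    (h0v : segment_at r x t₀ ≤ constHistory r v) {t : ℝ} (ht : t₀ - r ≤ t) (htT : (t : EReal) < T) :
    x t ∈ Icc 0 v := by
  have hr := S.r_nonneg
  have hc₀ := hx.continuousOn_Icc le_rfl hx.lt
  rcases le_total t t₀ with h | h
  · exact ⟨(constHistory_le_segment_at_iff hc₀ 0).1 h0 t ⟨ht, h⟩,
      (segment_at_le_constHistory_iff hc₀ v).1 h0v t ⟨ht, h⟩⟩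
  · have hc := hx.continuousOn_Icc (by linarith) htT (a := t - r)
    exact ⟨(constHistory_le_segment_at_iff hc 0).1 (hx.ge_of_field_nonneg S ht₀
        (fun i => by rw [h_eq]; rfl) h0 h htT) t ⟨by linarith, le_rfl⟩,
      (segment_at_le_constHistory_iff hc v).1 (hx.le_of_field_nonpos S ht₀ hvf h0v h htT) t
        ⟨by linarith, le_rfl⟩⟩

open scoped Pointwise in
/-- A solution on a bounded interval with values in `[0, v]` extends continuously to the line. -/
theorem exists_continuous_extension {τ : ℝ} (S : IsMonotoneDelaySystem r f g)
    (hx : IsDelayedSolution r f g t₀ τ x) (ht₀ : 0 ≤ t₀) {v : Fin n → ℝ}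
    (hxv : ∀ t, t₀ - r ≤ t → t < τ → x t ∈ Icc 0 v) :
    ∃ z : ℝ → Fin n → ℝ, Continuous z ∧ EqOn z x (Ico (t₀ - r) τ) := by
  have hr := S.r_nonneg
  -- The velocity is bounded: f is bounded on the compact box, and the delayed term lies between its
  -- values at the constants 0 and v.
  have hb : Bornology.IsBounded (f '' Icc 0 v + Icc (g 0 (constHistory r 0))
      (g 0 (constHistory r v))) :=
    (isCompact_Icc.image S.f_lip.continuous).isBounded.add isCompact_Icc.isBounded
  obtain ⟨C, hC, hCb⟩ := hb.exists_pos_norm_le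
  have hbound : ∀ t ∈ Ico t₀ τ, ‖f (x t) + g t (segment_at r x t)‖ ≤ C := by
    intro t ht
    have ht0 : 0 ≤ t := ht₀.trans ht.1
    have hc := hx.continuousOn_Icc (by linarith [ht.1]) (EReal.coe_lt_coe_iff.2 ht.2) (a := t - r)
    have hs : ∀ s ∈ Icc (t - r) t, x s ∈ Icc 0 v := fun s hs =>
      hxv s (by linarith [hs.1, ht.1]) (hs.2.trans_lt ht.2)
    refine hCb _ (add_mem_add (mem_image_of_mem f (hs t ⟨by linarith, le_rfl⟩)) ⟨?_, ?_⟩)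
    · rw [← S.g_const _ t ht0]
      exact S.g_mono t ht0 _ _ ((constHistory_le_segment_at_iff hc _).2 fun s h => (hs s h).1)
    · rw [← S.g_const _ t ht0]
      exact S.g_mono t ht0 _ _ ((segment_at_le_constHistory_iff hc _).2 fun s h => (hs s h).2)
  have hlip : LipschitzOnWith ⟨C, hC.le⟩ x (Ico t₀ τ) :=
    (convex_Ico t₀ τ).lipschitzOnWith_of_nnnorm_hasDerivWithin_le
      (fun t ht => (hx.hasDeriv t ht.1 (EReal.coe_lt_coe_iff.2 ht.2)).mono Ico_subset_Ici_self)
      hbound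
  obtain ⟨u, hu, hxu⟩ := hlip.extend_pi
  have hc₀ := hx.continuousOn_Icc le_rfl hx.lt
  have hlt : t₀ < τ := EReal.coe_lt_coe_iff.1 hx.lt
  -- Before t₀ the second summand vanishes; after t₀ the first is frozen at x(t₀), and u supplies
  -- the increment.
  refine ⟨fun t => pastExtension hr (segment_at r x t₀) t₀ t + (u (max t t₀) - u t₀),
    continuous_pastExtension.add ((hu.continuous.comp (by fun_prop)).sub continuous_const),
    fun t ht => ?_⟩
  rcases le_total t t₀ with h | h
  · simp only [max_eq_right h, sub_self, add_zero]
    exact pastExtension_segment_at hc₀ ⟨ht.1, h⟩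
  · simp only [max_eq_left h]
    rw [pastExtension_of_ge h, pastExtension_segment_at hc₀ ⟨by linarith, le_rfl⟩,
      ← hxu ⟨h, ht.2⟩, ← hxu ⟨le_rfl, hlt⟩, add_sub_cancel]

/-- A solution that is continuous up to the end point `τ` of its interval can be continued by a
solution starting at `τ` with the same history. -/
theorem glue {τ : ℝ} (S : IsMonotoneDelaySystem r f g) (hx : IsDelayedSolution r f g t₀ τ x)
    (ht₀ : 0 ≤ t₀) {w z : ℝ → Fin n → ℝ} (hw : Continuous w) (hwx : EqOn w x (Ico (t₀ - r) τ))
    (hz : IsDelayedSolution r f g τ ⊤ z) (hzc : Continuous z)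
    (hzw : segment_at r z τ = segment_at r w τ) :
    IsDelayedSolution r f g t₀ ⊤ fun t => if t ≤ τ then w t else z t := by
  have hr := S.r_nonneg
  have hlt : t₀ < τ := EReal.coe_lt_coe_iff.1 hx.lt
  have heq : EqOn z w (Icc (τ - r) τ) := fun t ht => by
    rw [← pastExtension_segment_at (hr := hr) hzc.continuousOn ht, hzw,
      pastExtension_segment_at hw.continuousOn ht]
  set Z : ℝ → Fin n → ℝ := fun t => if t ≤ τ then w t else z t with hZ
  have hZc : Continuous Z := Continuous.if_le hw hzc continuous_id continuous_const fun t ht => by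
    rw [show t = τ from ht]
    exact (heq ⟨by linarith, le_rfl⟩).symm
  have hZx : EqOn Z x (Ico (t₀ - r) τ) := fun t ht => by
    simp only [hZ, if_pos ht.2.le, hwx ht]
  have hZz : EqOn Z z (Ici (τ - r)) := fun t ht => by
    by_cases h : t ≤ τ
    · simp only [hZ, if_pos h, heq ⟨ht, h⟩]
    · simp only [hZ, if_neg h]
  have hleft : ∀ t ∈ Ico t₀ τ,
      HasDerivWithinAt Z (f (Z t) + g t (segment_at r Z t)) (Ici t₀) t := by
    intro t ht
    have h1 : segment_at r Z t = segment_at r x t := segment_at_congr fun s hs =>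
      hZx ⟨by linarith [hs.1, ht.1], hs.2.trans_lt ht.2⟩
    have h2 : Z t = x t := hZx ⟨by linarith [ht.1], ht.2⟩
    rw [h1, h2]
    refine (hx.hasDeriv t ht.1 (EReal.coe_lt_coe_iff.2 ht.2)).congr_of_eventuallyEq ?_ h2
    filter_upwards [self_mem_nhdsWithin, mem_nhdsWithin_of_mem_nhds (Iio_mem_nhds ht.2)] with s h3 h4
    exact hZx ⟨by linarith [mem_Ici.1 h3], h4⟩
  have hright : ∀ t, τ ≤ t → HasDerivWithinAt Z (f (Z t) + g t (segment_at r Z t)) (Ici τ) t := by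
    intro t ht
    have h1 : segment_at r Z t = segment_at r z t := segment_at_congr fun s hs =>
      hZz (mem_Ici.2 (by linarith [hs.1]))
    have h2 : Z t = z t := hZz (mem_Ici.2 (by linarith))
    rw [h1, h2]
    exact (hz.hasDeriv t ht (EReal.coe_lt_top t)).congr
      (hZz.mono (Ici_subset_Ici.2 (by linarith))) h2
  refine ⟨EReal.coe_lt_top t₀, hZc.continuousOn, fun t ht _ => ?_⟩
  rcases lt_trichotomy t τ with h | rfl | h
  · exact hleft t ⟨ht, h⟩
  -- At the junction the left derivative is the limit of the derivatives on the left, by continuity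
  -- of the right-hand side along Z; it matches the right derivative supplied by z.
  · have hR := S.continuous_rhs hZc
    have hd : ∀ s ∈ Ioo t₀ t, HasDerivAt Z (f (Z s) + g s (segment_at r Z s)) s := fun s hs =>
      (hleft s ⟨hs.1.le, hs.2⟩).hasDerivAt (Ici_mem_nhds hs.1)
    have hIic : HasDerivWithinAt Z (f (Z t) + g t (segment_at r Z t)) (Iic t) t := by
      refine hasDerivWithinAt_Iic_of_tendsto_deriv (s := Ioo t₀ t)
        (fun s hs => (hd s hs).differentiableAt.differentiableWithinAt)
        hZc.continuousWithinAt (Ioo_mem_nhdsLT hlt) ?_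
      have h1 := (hR.tendsto t).mono_left (nhdsWithin_le_nhds (s := Iio t))
      rw [max_eq_left (ht₀.trans ht)] at h1
      refine h1.congr' ?_
      filter_upwards [Ioo_mem_nhdsLT hlt] with s hs
      rw [(hd s hs).deriv, max_eq_left (ht₀.trans hs.1.le)]
    have h2 := hIic.union (hright t le_rfl)
    rw [Iic_union_Ici] at h2
    exact h2.mono (subset_univ _)
  · exact ((hright t h.le).hasDerivAt (Ici_mem_nhds h)).hasDerivWithinAt

end IsDelayedSolution

theorem IsMonotoneDelaySystem.isForwardCompleteOnCone {n : ℕ} {r : ℝ}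
    {f : (Fin n → ℝ) → (Fin n → ℝ)} {g : ℝ → History n r → (Fin n → ℝ)}
    (S : IsMonotoneDelaySystem r f g) (h_eq : undelayedField r f g 0 = 0) {y : ℝ → Fin n → ℝ}
    (hy : IsEntireUndelayedSolution r f g y)
    (hy_bot : ∀ i, Tendsto (fun t => y t i) atBot atTop) : IsForwardCompleteOnCone r f g := by
  have hr := S.r_nonneg
  refine fun t₀ ht₀ => ⟨fun φ hφ => ?_, fun T x hx h0 => ?_⟩
  · obtain ⟨v, hv, hvf, hφv⟩ := S.exists_upper_bound hy hy_bot φ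
    obtain ⟨x, -, hx, hxφ⟩ := S.exists_solution h_eq hv hvf hφ hφv ht₀
    exact ⟨x, hx, hxφ⟩
  · obtain ⟨v, hv, hvf, h0v⟩ := S.exists_upper_bound hy hy_bot (segment_at r x t₀)
    induction T using EReal.rec with
    | bot => exact absurd hx.lt not_lt_bot
    | top => exact ⟨x, hx, fun _ _ => rfl⟩
    | coe τ =>
      have hlt : t₀ < τ := EReal.coe_lt_coe_iff.1 hx.lt
      have hxv : ∀ t, t₀ - r ≤ t → t < τ → x t ∈ Icc 0 v := fun t ht htτ =>
        hx.mem_Icc_of_field_nonpos S h_eq ht₀ hvf h0 h0v ht (EReal.coe_lt_coe_iff.2 htτ)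
      obtain ⟨w, hw, hwx⟩ := hx.exists_continuous_extension S ht₀ hxv
      -- The box is closed, so the bounds persist at τ and existence can be restarted there in the
      -- same box.
      have hwv : ∀ t, t₀ - r ≤ t → t ≤ τ → w t ∈ Icc 0 v := by
        intro t ht htτ
        rcases htτ.eq_or_lt with rfl | h
        · refine isClosed_Icc.mem_of_tendsto
            ((hw.tendsto t).mono_left (nhdsWithin_le_nhds (s := Iio t))) ?_
          filter_upwards [Ioo_mem_nhdsLT hlt] with s hs
          have hs' : s ∈ Ico (t₀ - r) t := ⟨by linarith [hs.1], hs.2⟩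
          rw [hwx hs']
          exact hxv s hs'.1 hs'.2
        · rw [hwx ⟨ht, h⟩]
          exact hxv t ht h
      obtain ⟨z, hzc, hz, hzw⟩ := S.exists_solution h_eq hv hvf
        ((constHistory_le_segment_at_iff hw.continuousOn 0).2 fun s hs =>
          (hwv s (by linarith [hs.1]) hs.2).1)
        ((segment_at_le_constHistory_iff hw.continuousOn v).2 fun s hs =>
          (hwv s (by linarith [hs.1]) hs.2).2) (ht₀.trans hlt.le)
      refine ⟨_, hx.glue S ht₀ hw hwx hz hzc hzw, fun t ht => ?_⟩
      have htτ : t < τ := EReal.coe_lt_coe_iff.1 ht.2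
      simp only [if_pos htτ.le]
      exact (hwx ⟨ht.1, htτ⟩).symm

theorem mainTheorem1 (n : ℕ) (r : ℝ) (hr : 0 ≤ r)
    (f : (Fin n → ℝ) → (Fin n → ℝ)) (g : ℝ → History n r → (Fin n → ℝ))
    (hf_mono : ∀ x y : Fin n → ℝ, x ≤ y → ∀ i, x i = y i → f x i ≤ f y i)
    (hg_mono : ∀ t : ℝ, 0 ≤ t → ∀ φ ψ : History n r, φ ≤ ψ → g t φ ≤ g t ψ)
    (hf_lip : LocallyLipschitz f)
    (hg_lip : ∀ t : ℝ, 0 ≤ t → LocallyLipschitz (g t))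
    (hg_cont : ∀ φ : History n r, ContinuousOn (fun t => g t φ) (Set.Ici 0))
    (hg_const : ∀ v : Fin n → ℝ, ∀ t : ℝ, 0 ≤ t →
      g t (constHistory r v) = g 0 (constHistory r v))
    (h_eq : ∀ t : ℝ, 0 ≤ t → f 0 + g t (constHistory r 0) = 0)
    (y : ℝ → Fin n → ℝ) (hy : IsEntireUndelayedSolution r f g y)
    (hy_bot : ∀ i, Filter.Tendsto (fun t => y t i) Filter.atBot Filter.atTop)
    (hy_top : ∀ i, Filter.Tendsto (fun t => y t i) Filter.atTop (nhds 0)) :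
    IsForwardCompleteOnCone r f g ∧ IsGloballyAsymptoticallyStable r f g := by
  have S : IsMonotoneDelaySystem r f g :=
    ⟨hr, hf_mono, hg_mono, hf_lip, hg_lip, hg_cont, hg_const⟩
  have h0 : undelayedField r f g 0 = 0 := h_eq 0 le_rfl
  exact ⟨S.isForwardCompleteOnCone h0 hy hy_bot,
    S.isStableOnCone h0 hy hy_bot hy_top,
    fun t₀ ht₀ x hx hx0 => hx.tendsto_zero S h0 hy hy_bot hy_top ht₀ hx0⟩
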